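/- Let $\mu,\nu>0$ and let $\theta:[0,\infty)\to\mathbb R$ be smooth with $\theta(0)=1$ and $\theta(r)=0$ for all $r\ge r_0$, for some $r_0>0$. Let $W:[-1/e,\infty)\to[-1,\infty)$ be the principal branch of the Lambert function (the inverse of $s\mapsto se^s$, $s\ge -1$), and for $r>0$ put $$\mathcal E(r)=-\frac{\big(W(e^{\theta(r)})-\theta(r)\big)^2}{\nu r^2}.$$ For $\lambda>0$ let $G^\lambda(x)=e^{-\sqrt{\lambda\nu}\,|x|}/|x|$ on $\mathbb R^3$. For $y\in\mathbb R^3\setminus\{0\}$ let $h(y)$ be the operator in $L^2(\mathbb R^3;\mathbb C)$ whose domain consists of the functions $$u=\omega+q\,G^\lambda(\cdot+y/2)+q\,G^\lambda(\cdot-y/2),\qquad \omega\in H^2(\mathbb R^3),\ q\in\mathbb C,\qquad \omega(\pm y/2)=q\Big(\frac{\theta(|y|)}{|y|}+\sqrt{\lambda\nu}-G^\lambda(y)\Big),$$ with action $(h(y)+\lambda)u=\big(-\tfrac1\nu\Delta+\lambda\big)\omega$ (two non-local point interactions at $\pm y/2$; $\lambda>0$ is an auxiliary parameter, and the statement holds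 for every choice of it). Let $h_{\mathcal E}=-\tfrac1\mu\Delta+\mathcal E(|\cdot|)$ in $L^2(\mathbb R^3;\mathbb C)$ with domain $H^2(\mathbb R^3)$. Then: (i) For every $y\neq0$ with $\theta(|y|)<1$, the number $\mathcal E(|y|)$ is negative and is an eigenvalue of $h(y)$; it is the only negative eigenvalue of $h(y)$, and its eigenvectors are exactly the functions $q\big(G^{-\mathcal E(|y|)}(\cdot+y/2)+G^{-\mathcal E(|y|)}(\cdot-y/2)\big)$ with $q\in\mathbb C\setminus\{0\}$. (ii) If $\frac{\mu}{\nu}W(1)^2>\frac14$, then $h_{\mathcal E}$ has a strictly increasing infinite sequence of negative eigenvalues $(E_{\mathrm{BO};n})_{n\in\mathbb N}$ such that $$\lim_{n\to\infty}E_{\mathrm{BO};n}=0,\qquad \lim_{n\to\infty}\frac{E_{\mathrm{BO};n}}{E_{\mathrm{BO};n+1}}=e^{2\pi/\beta},\qquad \beta=\sqrt{\frac{\mu}{\nu}W(1)^2-\frac14}.$$ -/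

import Mathlib

open MeasureTheory Filter Topology
open scoped SchwartzMap Laplacian

noncomputable section

namespace BornOppenheimer

/-- The physical space `ℝ³`. -/
abbrev R3 : Type := EuclideanSpace ℝ (Fin 3)

/-- The Hilbert space `L²(ℝ³; ℂ)`. -/
abbrev L2 : Type := Lp ℂ 2 (volume : Measure R3)

/-- The embedding of `L²(ℝ³)` into the tempered distributions. -/
abbrev toDist : L2 →L[ℂ] 𝓢'(R3, ℂ) := Lp.toTemperedDistributionCLM ℂ volume 2

/-- The Sobolev space `H²(ℝ³)`, as a set of `L²` functions. -/
def MemH2 (u : L2) : Prop := TemperedDistribution.MemSobolev 2 2 (toDist u)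

/-- The principal branch of the Lambert function, that is, the inverse of
`[-1, ∞) → [-1/e, ∞)`, `s ↦ s * exp s`. -/
def lambertW (x : ℝ) : ℝ := Function.invFunOn (fun s : ℝ => s * Real.exp s) (Set.Ici (-1)) x

/-- `G^l(x) = exp(-√(l ν) |x|) / |x|`. -/
def green (ν l : ℝ) (x : R3) : ℝ := Real.exp (-(Real.sqrt (l * ν) * ‖x‖)) / ‖x‖

/-- The sum `G^l(x + y/2) + G^l(x - y/2)` of the Green's functions centred at `∓ y/2`. -/
def greenSum (ν l : ℝ) (y x : R3) : ℝ :=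
  green ν l (x + (1 / 2 : ℝ) • y) + green ν l (x - (1 / 2 : ℝ) • y)

/-- `𝓔(r) = -(W(exp (θ(r))) - θ(r))² / (ν r²)`, the effective potential of the slow dynamics. -/
def effPotential (ν : ℝ) (θ : ℝ → ℝ) (r : ℝ) : ℝ :=
  -((lambertW (Real.exp (θ r)) - θ r) ^ 2 / (ν * r ^ 2))

/-- `u = w + q (G^l(· + y/2) + G^l(· - y/2))` with `w ∈ H²(ℝ³)`, `q ∈ ℂ`, and
`w(± y/2) = q (θ(|y|)/|y| + √(l ν) - G^l(y))`; the values of `w` at the two points are those of its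
continuous representative `w'`. -/
def FastDecomposition (ν : ℝ) (θ : ℝ → ℝ) (y : R3) (l : ℝ) (u w : L2) (q : ℂ) : Prop :=
  MemH2 w ∧
  (u =ᵐ[volume] fun x => w x + q * (greenSum ν l y x : ℂ)) ∧
  ∃ w' : R3 → ℂ, Continuous w' ∧ w =ᵐ[volume] w' ∧
    w' ((1 / 2 : ℝ) • y) = q * ((θ ‖y‖ / ‖y‖ + Real.sqrt (l * ν) - green ν l y : ℝ) : ℂ) ∧
    w' (-((1 / 2 : ℝ) • y)) = q * ((θ ‖y‖ / ‖y‖ + Real.sqrt (l * ν) - green ν l y : ℝ) : ℂ)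

theorem laplacian_add (f g : 𝓢'(R3, ℂ)) : Δ (f + g) = Δ f + Δ g := by
  simp only [← TemperedDistribution.laplacianCLM_apply, map_add]

theorem laplacian_smul (c : ℂ) (f : 𝓢'(R3, ℂ)) : Δ (c • f) = c • Δ f := by
  simp only [← TemperedDistribution.laplacianCLM_apply, map_smul]

theorem laplacian_zero : Δ (0 : 𝓢'(R3, ℂ)) = 0 := by
  simp only [← TemperedDistribution.laplacianCLM_apply, map_zero]

theorem smul_dist_zero (c : ℂ) : c • (0 : 𝓢'(R3, ℂ)) = 0 := by
  rw [← map_zero toDist, ← map_smul, smul_zero]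

/-- The graph of the fast Hamiltonian `h(y)`: the pairs `(u, v)` with `u` in the domain and
`v + l u = (-(1/ν) Δ + l) w`, where `w` is the regular part of `u`. -/
def fastGraph (ν : ℝ) (θ : ℝ → ℝ) (y : R3) (l : ℝ) : Submodule ℂ (L2 × L2) where
  carrier := {p | ∃ (w : L2) (q : ℂ), FastDecomposition ν θ y l p.1 w q ∧
    toDist (p.2 + (l : ℂ) • p.1) =
      -(((1 / ν : ℝ) : ℂ) • Δ (toDist w)) + (l : ℂ) • toDist w}
  zero_mem' := by
    refine ⟨0, 0, ⟨?_, ?_, 0, continuous_zero, Lp.coeFn_zero _ _ _, by simp, by simp⟩, ?_⟩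
    · simp only [MemH2, map_zero]
      exact TemperedDistribution.memSobolev_fun_zero _ _ _ _
    · filter_upwards [Lp.coeFn_zero ℂ 2 (volume : Measure R3)] with x a
      simp only [Prod.fst_zero, a, Pi.zero_apply, zero_mul, add_zero]
    · simp only [Prod.fst_zero, Prod.snd_zero, smul_zero, add_zero, map_zero, laplacian_zero,
        smul_dist_zero, neg_zero]
  add_mem' := by
    rintro p p' ⟨w, q, ⟨h1, h2, f, hf, hwf, e1, e2⟩, h3⟩
      ⟨w', q', ⟨h1', h2', f', hf', hwf', e1', e2'⟩, h3'⟩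
    refine ⟨w + w', q + q', ⟨?_, ?_, f + f', hf.add hf', ?_, ?_, ?_⟩, ?_⟩
    · simp only [MemH2, map_add]
      exact h1.add h1'
    · filter_upwards [Lp.coeFn_add p.1 p'.1, Lp.coeFn_add w w', h2, h2'] with x a b c d
      simp only [Prod.fst_add, a, b, c, d, Pi.add_apply]
      ring
    · filter_upwards [Lp.coeFn_add w w', hwf, hwf'] with x a b c
      simp only [a, b, c, Pi.add_apply]
    · simp only [Pi.add_apply, e1, e1']
      ring
    · simp only [Pi.add_apply, e2, e2']
      ring
    · have : (p + p').2 + (l : ℂ) • (p + p').1 =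
          (p.2 + (l : ℂ) • p.1) + (p'.2 + (l : ℂ) • p'.1) := by
        simp only [Prod.fst_add, Prod.snd_add, smul_add]
        abel
      rw [this, map_add, h3, h3', map_add, laplacian_add, smul_add, smul_add]
      abel
  smul_mem' := by
    rintro c p ⟨w, q, ⟨h1, h2, f, hf, hwf, e1, e2⟩, h3⟩
    refine ⟨c • w, c * q, ⟨?_, ?_, c • f, hf.const_smul c, ?_, ?_, ?_⟩, ?_⟩
    · simp only [MemH2, map_smul]
      exact h1.smul c
    · filter_upwards [Lp.coeFn_smul c p.1, Lp.coeFn_smul c w, h2] with x a b d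
      simp only [Prod.smul_fst, a, b, d, Pi.smul_apply, smul_eq_mul]
      ring
    · filter_upwards [Lp.coeFn_smul c w, hwf] with x a b
      simp only [a, b, Pi.smul_apply]
    · simp only [Pi.smul_apply, e1, smul_eq_mul]
      ring
    · simp only [Pi.smul_apply, e2, smul_eq_mul]
      ring
    · have : (c • p).2 + (l : ℂ) • (c • p).1 = c • (p.2 + (l : ℂ) • p.1) := by
        simp only [Prod.smul_fst, Prod.smul_snd, smul_add, smul_comm c (l : ℂ)]
      rw [this, map_smul, h3, map_smul, laplacian_smul, smul_add, smul_neg, smul_comm c, smul_comm c]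

/-- The graph of the slow Hamiltonian: the pairs `(u, v)` with `u ∈ H²(ℝ³)` and
`v = -(1/μ) Δ u + V(|·|) u`. -/
def slowGraph (μ : ℝ) (V : ℝ → ℝ) : Submodule ℂ (L2 × L2) where
  carrier := {p | MemH2 p.1 ∧ ∃ w : L2, toDist w = -(((1 / μ : ℝ) : ℂ) • Δ (toDist p.1)) ∧
    p.2 =ᵐ[volume] fun x => w x + (V ‖x‖ : ℂ) * p.1 x}
  zero_mem' := by
    refine ⟨?_, 0, ?_, ?_⟩
    · simp only [MemH2, Prod.fst_zero, map_zero]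
      exact TemperedDistribution.memSobolev_fun_zero _ _ _ _
    · simp only [Prod.fst_zero, map_zero, laplacian_zero, smul_dist_zero, neg_zero]
    · filter_upwards [Lp.coeFn_zero ℂ 2 (volume : Measure R3)] with x a
      simp only [Prod.fst_zero, Prod.snd_zero, a, Pi.zero_apply, mul_zero, add_zero]
  add_mem' := by
    rintro p p' ⟨h1, w, h2, h3⟩ ⟨h1', w', h2', h3'⟩
    refine ⟨?_, w + w', ?_, ?_⟩
    · simp only [MemH2, Prod.fst_add, map_add]
      exact h1.add h1'
    · rw [map_add, h2, h2', Prod.fst_add, map_add, laplacian_add, smul_add]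
      abel
    · filter_upwards [Lp.coeFn_add p.1 p'.1, Lp.coeFn_add p.2 p'.2, Lp.coeFn_add w w', h3, h3']
        with x a b c d e
      simp only [Prod.fst_add, Prod.snd_add, a, b, c, d, e, Pi.add_apply]
      ring
  smul_mem' := by
    rintro c p ⟨h1, w, h2, h3⟩
    refine ⟨?_, c • w, ?_, ?_⟩
    · simp only [MemH2, Prod.smul_fst, map_smul]
      exact h1.smul c
    · rw [map_smul, h2, Prod.smul_fst, map_smul, laplacian_smul, smul_neg, smul_comm c]
    · filter_upwards [Lp.coeFn_smul c p.1, Lp.coeFn_smul c p.2, Lp.coeFn_smul c w, h3]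
        with x a b d e
      simp only [Prod.smul_fst, Prod.smul_snd, a, b, d, e, Pi.smul_apply, smul_eq_mul]
      ring

theorem toDist_injective : Function.Injective toDist := by
  intro u v huv
  have hu : toDist (u - v) = 0 := by rw [map_sub, huv, sub_self]
  have hk : u - v ∈ (Lp.toTemperedDistributionCLM ℂ (volume : Measure R3) 2).ker := by
    rw [LinearMap.mem_ker]
    exact hu
  rw [Lp.ker_toTemperedDistributionCLM_eq_bot] at hk
  exact sub_eq_zero.mp ((Submodule.mem_bot ℂ).mp hk)

theorem tendsto_green (ν l : ℝ) : Tendsto (green ν l) (𝓝[≠] 0) atTop := by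
  have h1 : Tendsto (fun x : R3 => ‖x‖⁻¹) (𝓝[≠] 0) atTop :=
    tendsto_inv_nhdsGT_zero.comp tendsto_norm_nhdsNE_zero
  have h2 : Tendsto (fun x : R3 => Real.exp (-(Real.sqrt (l * ν) * ‖x‖))) (𝓝[≠] 0) (𝓝 1) := by
    have : Continuous (fun x : R3 => Real.exp (-(Real.sqrt (l * ν) * ‖x‖))) := by fun_prop
    have h := (this.tendsto 0).mono_left (nhdsWithin_le_nhds (s := {0}ᶜ))
    simpa using h
  exact (h2.pos_mul_atTop one_pos h1).congr fun x => by simp [green, div_eq_mul_inv]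

theorem charge_eq_zero (ν l : ℝ) (y : R3) (q : ℂ) (f : R3 → ℂ) (hf : Continuous f)
    (hae : ∀ᵐ x : R3, f x + q * (greenSum ν l y x : ℂ) = 0) : q = 0 := by
  by_contra hq
  set a : R3 := (1 / 2 : ℝ) • y with ha
  have hshift : Tendsto (fun x : R3 => x - a) (𝓝[≠] a) (𝓝[≠] 0) := by
    refine tendsto_nhdsWithin_iff.mpr ⟨?_, ?_⟩
    · have : Continuous (fun x : R3 => x - a) := by fun_prop
      simpa using (this.tendsto a).mono_left (nhdsWithin_le_nhds (s := {a}ᶜ))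
    · filter_upwards [self_mem_nhdsWithin] with x hx
      simpa [sub_eq_zero] using hx
  have hG := (tendsto_green ν l).comp hshift
  have hb : ∀ᶠ x in 𝓝[≠] a, ‖f x‖ < ‖f a‖ + 1 :=
    (hf.norm.tendsto a).mono_left (nhdsWithin_le_nhds (s := {a}ᶜ)) |>.eventually
      (gt_mem_nhds (by linarith))
  have hev := hb.and (hG.eventually_gt_atTop ((‖f a‖ + 1) / ‖q‖))
  rw [eventually_nhdsWithin_iff, eventually_nhds_iff] at hev
  obtain ⟨U, hU, hUo, haU⟩ := hev
  have hne : (U ∩ {a}ᶜ).Nonempty := by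
    have : (𝓝[≠] a).NeBot := inferInstance
    exact this.nonempty_of_mem (inter_mem (mem_nhdsWithin_of_mem_nhds (hUo.mem_nhds haU))
      self_mem_nhdsWithin)
  obtain ⟨x, ⟨hxU, hxa⟩, hx⟩ := (Measure.dense_of_ae hae).inter_open_nonempty _
    (hUo.inter isOpen_compl_singleton) hne
  obtain ⟨k1, k2⟩ := hU x hxU hxa
  have hqpos : 0 < ‖q‖ := norm_pos_iff.mpr hq
  have k3 : green ν l (x - a) ≤ greenSum ν l y x := by
    have : 0 ≤ green ν l (x + a) := by
      unfold green
      positivity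
    simp only [greenSum, ← ha]
    linarith
  have k4 : ‖f x‖ = ‖q‖ * |greenSum ν l y x| := by
    have : f x = -(q * (greenSum ν l y x : ℂ)) := eq_neg_of_add_eq_zero_left hx
    rw [this, norm_neg, norm_mul, Complex.norm_real, Real.norm_eq_abs]
  have k5 : ‖f a‖ + 1 < green ν l (x - a) * ‖q‖ := (div_lt_iff₀ hqpos).mp k2
  have k6 := le_abs_self (greenSum ν l y x)
  nlinarith [mul_le_mul_of_nonneg_left (k3.trans k6) hqpos.le]

/-- The decomposition of an element of the domain of `h(y)` is unique, so that `fastGraph` is the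
graph of an operator. -/
theorem fastGraph_functional (ν : ℝ) (θ : ℝ → ℝ) (y : R3) (l : ℝ) :
    ∀ p ∈ fastGraph ν θ y l, p.1 = 0 → p.2 = 0 := by
  intro p hmem hp
  obtain ⟨w, q, ⟨-, h2, f, hf, hwf, -, -⟩, h3⟩ := hmem
  rw [hp] at h2 h3
  have hz := Lp.coeFn_zero ℂ 2 (volume : Measure R3)
  have hq : q = 0 := by
    refine charge_eq_zero ν l y q f hf ?_
    filter_upwards [hz, h2, hwf] with x b c d
    rw [← d, ← c, b, Pi.zero_apply]
  have hw : w = 0 := by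
    rw [Lp.eq_zero_iff_ae_eq_zero]
    filter_upwards [hz, h2] with x b c
    rw [b, hq, zero_mul, add_zero] at c
    exact c.symm
  apply toDist_injective
  rw [hw] at h3
  simpa only [smul_zero, add_zero, map_zero, laplacian_zero, smul_dist_zero, neg_zero] using h3

/-- `slowGraph` is the graph of an operator. -/
theorem slowGraph_functional (μ : ℝ) (V : ℝ → ℝ) :
    ∀ p ∈ slowGraph μ V, p.1 = 0 → p.2 = 0 := by
  rintro p ⟨-, w, h2, h3⟩ hp
  have hw : w = 0 := by
    apply toDist_injective
    rw [hp] at h2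
    simpa only [map_zero, laplacian_zero, smul_dist_zero, neg_zero] using h2
  rw [Lp.eq_zero_iff_ae_eq_zero]
  filter_upwards [h3, Lp.coeFn_zero ℂ 2 (volume : Measure R3)] with x a b
  rw [a, hw, hp, b]
  simp

/-- The fast Hamiltonian `h(y)` with two point interactions placed at `± y/2`, described through
the Green's functions with parameter `l > 0`. -/
def fastHamiltonian (ν : ℝ) (θ : ℝ → ℝ) (y : R3) (l : ℝ) : L2 →ₗ.[ℂ] L2 :=
  (fastGraph ν θ y l).toLinearPMap

theorem graph_fastHamiltonian (ν : ℝ) (θ : ℝ → ℝ) (y : R3) (l : ℝ) :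
    (fastHamiltonian ν θ y l).graph = fastGraph ν θ y l :=
  Submodule.toLinearPMap_graph_eq _ (fastGraph_functional ν θ y l)

/-- The slow Hamiltonian `-(1/μ) Δ + V(|·|)`, with domain `H²(ℝ³)` when `V` is bounded. -/
def slowHamiltonian (μ : ℝ) (V : ℝ → ℝ) : L2 →ₗ.[ℂ] L2 :=
  (slowGraph μ V).toLinearPMap

theorem graph_slowHamiltonian (μ : ℝ) (V : ℝ → ℝ) :
    (slowHamiltonian μ V).graph = slowGraph μ V :=
  Submodule.toLinearPMap_graph_eq _ (slowGraph_functional μ V)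

/-- `u` is an eigenvector of the unbounded operator `T` with eigenvalue `z`. -/
def IsEigenvector (T : L2 →ₗ.[ℂ] L2) (z : ℂ) (u : L2) : Prop :=
  u ≠ 0 ∧ ∃ hu : u ∈ T.domain, T ⟨u, hu⟩ = z • u

/-- `z` is an eigenvalue of the unbounded operator `T`. -/
def IsEigenvalue (T : L2 →ₗ.[ℂ] L2) (z : ℂ) : Prop := ∃ u : L2, IsEigenvector T z u

end BornOppenheimer

end

/-! Fast Hamiltonian. Let `-l'` be a negative energy. A difference of Green's functions with
parameters `l'` and `l` has no delta at its centre, lies in H², and satisfies Δ(G^{l'} - G^l) = l'ν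
G^{l'} - lν G^l. Subtracting q times this difference (summed over the two centres) from the regular
part of an eigenvector leaves an L² solution of Δf = l'ν f, which is zero because the Fourier symbol
has no zeros (`eq_zero_of_laplacian_eq_smul`). The eigenvector is therefore q times the Green's sum
at `l'`, and only the condition at ±y/2 remains. There the auxiliary `l` cancels, and with s =
√(l'ν)|y| the condition reads e^{-s} - s = θ(|y|) (`mem_fastGraph_iff`). The left side is strictly
decreasing with inverse a ↦ W(e^a) - a, so θ(|y|) < 1 gives exactly one s > 0.

Slow Hamiltonian. For u = χ(|x|)/|x| with χ(0) = 0 the eigenvalue equation at energy -l/μ becomes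
χ'' = (l - Q)χ with Q = -μ𝓔. The function Q is bounded, because W(e^θ) - θ vanishes linearly at r =
0, and Q = (β² + 1/4)/r² for r ≥ r₀. Put l = e^{2ζ} and χ = √r g(ζ + log r); the exterior equation
turns into g'' = (e^{2x} - β²)g, free of ζ. It has a solution decaying at +∞, the Macdonald function
K_{iβ}(e^x) up to a factor (`exists_decaying_solution`), and this solution oscillates like sin(βx +
ψ) at -∞ with nonzero amplitude (`exists_oscillation`).

An energy is an eigenvalue once the interior solution, with data (0, 1) at the origin, has vanishing
Wronskian at r₀ with the decaying exterior one (`exists_exp_bound_of_matching`,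
`isEigenvalue_slowHamiltonian`). As ζ → -∞ the interior data at r₀ converge to those at l = 0, so
the Wronskian is asymptotic to C cos(βζ + φ). Its zeros have spacing tending to π/β
(`exists_zeros_of_oscillation`), and the energies -e^{2ζ}/μ have ratio tending to e^{2π/β}. -/

noncomputable section

namespace BornOppenheimer

/-! ### Weak derivatives and Laplacian of radial functions on ℝ³ -/

/-- Integration by parts along a direction, for functions that need to be differentiable only away
from the line through the origin in that direction. -/
theorem integral_mul_prod_eq_neg_of_fst_ne_zero {E : Type*} [NormedAddCommGroup E]
    [MeasurableSpace E] {μ : Measure E} [SigmaFinite μ] [NullSingletonClass μ] {f f' g g' : E × ℝ → ℂ}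
    (hf'g : Integrable (fun x ↦ f' x * g x) (μ.prod volume))
    (hfg' : Integrable (fun x ↦ f x * g' x) (μ.prod volume))
    (hfg : Integrable (fun x ↦ f x * g x) (μ.prod volume))
    (hf : ∀ x : E, x ≠ 0 → ∀ t : ℝ, HasDerivAt (fun t => f (x, t)) (f' (x, t)) t)
    (hg : ∀ x : E, ∀ t : ℝ, HasDerivAt (fun t => g (x, t)) (g' (x, t)) t) :
    ∫ x, f x * g' x ∂(μ.prod volume) = - ∫ x, f' x * g x ∂(μ.prod volume) := calc
  ∫ x, f x * g' x ∂(μ.prod volume)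
    = ∫ x, (∫ t, f (x, t) * g' (x, t)) ∂μ := integral_prod _ hfg'
  _ = ∫ x, (- ∫ t, f' (x, t) * g (x, t)) ∂μ := by
    apply integral_congr_ae
    -- The only fibre on which `f` may fail to be differentiable lies over one point, which is null.
    have h0 : ∀ᵐ x ∂μ, x ≠ 0 := by simp [ae_iff]
    filter_upwards [hf'g.prod_right_ae, hfg'.prod_right_ae, hfg.prod_right_ae, h0]
      with x hf'gx hfg'x hfgx hx
    exact integral_mul_deriv_eq_deriv_mul_of_integrable (fun t _ => hf x hx t) (fun t _ => hg x t)
      hfg'x hf'gx hfgx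
  _ = - ∫ x, f' x * g x ∂(μ.prod volume) := by rw [integral_neg, integral_prod _ hf'g]

/-- A linear change of variables takes `v` to the last coordinate vector, and the exceptional line
ℝv to the fibre over 0. The Lebesgue measure becomes a multiple of the product measure. Since only
the products need to be integrable, `f` may be singular at the origin. -/
theorem integral_mul_eq_neg_of_hasDerivAt_line {f f' g g' : R3 → ℂ} {v : R3} (hv : v ≠ 0)
    (hf'g : Integrable (fun x ↦ f' x * g x)) (hfg' : Integrable (fun x ↦ f x * g' x))
    (hfg : Integrable (fun x ↦ f x * g x))
    (hf : ∀ x : R3, (∀ t : ℝ, x + t • v ≠ 0) → HasDerivAt (fun t : ℝ => f (x + t • v)) (f' x) 0)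
    (hg : ∀ x : R3, HasDerivAt (fun t : ℝ => g (x + t • v)) (g' x) 0) :
    ∫ x, f x * g' x = - ∫ x, f' x * g x := by
  let E' := Fin 2 → ℝ
  obtain ⟨L, hL⟩ : ∃ L : R3 ≃L[ℝ] (E' × ℝ), L v = (0, 1) := by
    have : Module.finrank ℝ (E' × ℝ) = Module.finrank ℝ R3 := by simp [E']
    have L₀ : R3 ≃L[ℝ] (E' × ℝ) := (ContinuousLinearEquiv.ofFinrankEq this).symm
    obtain ⟨M, hM⟩ : ∃ M : (E' × ℝ) ≃L[ℝ] (E' × ℝ), M (L₀ v) = (0, 1) := by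
      apply SeparatingDual.exists_continuousLinearEquiv_apply_eq
      · simpa using hv
      · simp
    exact ⟨L₀.trans M, by simp [hM]⟩
  have hLs : L.symm (0, 1) = v := by rw [← hL]; simp
  let m : Measure (E' × ℝ) := Measure.map L volume
  have L_emb : MeasurableEmbedding L := L.toHomeomorph.measurableEmbedding
  obtain ⟨c, hc⟩ : ∃ c : NNReal, m = c • (volume : Measure E').prod (volume : Measure ℝ) :=
    ⟨_, Measure.isAddLeftInvariant_eq_smul m ((volume : Measure E').prod (volume : Measure ℝ))⟩
  -- Proportionality is recorded in both directions, so that integrability passes to the product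
  -- measure without showing that `c` is nonzero.
  obtain ⟨d, hd⟩ : ∃ d : NNReal, (volume : Measure E').prod (volume : Measure ℝ) = d • m :=
    ⟨_, Measure.isAddLeftInvariant_eq_smul ((volume : Measure E').prod (volume : Measure ℝ)) m⟩
  have hline (x : E') (t s : ℝ) : L.symm (x, t) + s • v = L.symm (x, t + s) := by
    rw [← hLs, ← map_smul, ← map_add]
    simp
  have key : ∀ F F' : R3 → ℂ, ∀ (x : E') (t : ℝ),
      HasDerivAt (fun s : ℝ => F (L.symm (x, t) + s • v)) (F' (L.symm (x, t))) 0 →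
      HasDerivAt (fun s : ℝ => F (L.symm (x, s))) (F' (L.symm (x, t))) t := by
    intro F F' x t h
    have h2 : HasDerivAt (fun s : ℝ => s - t) 1 t := (hasDerivAt_id t).sub_const t
    have h3 := HasDerivAt.scomp_of_eq t h h2 (by simp)
    simp only [one_smul] at h3
    refine h3.congr_of_eventuallyEq (Eventually.of_forall fun s => ?_)
    simp [hline]
  have hI : ∀ F : R3 → ℂ, Integrable F → Integrable (fun z => F (L.symm z))
      ((volume : Measure E').prod (volume : Measure ℝ)) := by
    intro F hF
    rw [hd]
    apply Integrable.smul_measure_nnreal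
    rw [L_emb.integrable_map_iff]
    simpa [Function.comp_def] using hF
  have H := integral_mul_prod_eq_neg_of_fst_ne_zero (μ := (volume : Measure E'))
    (f := fun z => f (L.symm z)) (f' := fun z => f' (L.symm z))
    (g := fun z => g (L.symm z)) (g' := fun z => g' (L.symm z))
    (hI _ hf'g) (hI _ hfg') (hI _ hfg)
    (fun x hx t => key f f' x t (hf _ fun s => by
      rw [hline]
      simpa using fun h => absurd h hx))
    (fun x t => key g g' x t (hg _))
  have hfin : ∀ F : R3 → ℂ, ∫ x, F x = c • ∫ z, F (L.symm z)
      ∂((volume : Measure E').prod (volume : Measure ℝ)) := by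
    intro F
    rw [← integral_smul_nnreal_measure, ← hc, L_emb.integral_map]
    simp
  rw [hfin, hfin, H, smul_neg]

/-- The Jacobian r² of polar coordinates in dimension three cancels the singularity r⁻². This weight
dominates ρ = χ/r together with ρ', ρ'/r and ρ'' when χ vanishes linearly at 0 and has bounded
derivatives. -/
theorem integrable_one_add_inv_norm_sq_mul_schwartz (φ : 𝓢(R3, ℂ)) :
    Integrable (fun x : R3 => (1 + (‖x‖ ^ 2)⁻¹) * ‖φ x‖) := by
  have h1 : Integrable (fun x : R3 => (‖x‖ ^ 2)⁻¹ * (1 + ‖x‖ ^ 2)⁻¹) := by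
    refine (integrable_fun_norm_addHaar (volume : Measure R3)
      (f := fun y : ℝ => (y ^ 2)⁻¹ * (1 + y ^ 2)⁻¹)).mpr ?_
    refine (integrable_inv_one_add_sq.integrableOn (s := Set.Ioi 0)).congr_fun ?_
      measurableSet_Ioi
    intro y hy
    have : y ≠ 0 := (Set.mem_Ioi.mp hy).ne'
    simp [field]
  obtain ⟨C, hC⟩ : ∃ C : ℝ, ∀ x : R3, (1 + ‖x‖ ^ 2) * ‖φ x‖ ≤ C := by
    obtain ⟨C0, h0⟩ := φ.decay 0 0
    obtain ⟨C2, h2⟩ := φ.decay 2 0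
    refine ⟨C0 + C2, fun x => ?_⟩
    have a := h0.2 x
    have b := h2.2 x
    simp at a b
    linarith
  have hφ : Integrable (fun x : R3 => ‖φ x‖) := φ.integrable.norm
  have h2 : Integrable (fun x : R3 => (‖x‖ ^ 2)⁻¹ * ‖φ x‖) := by
    refine (h1.const_mul C).mono' ?_ (Eventually.of_forall fun x => ?_)
    · exact (by fun_prop : Measurable fun x : R3 => (‖x‖ ^ 2)⁻¹).aestronglyMeasurable.mul
        hφ.aestronglyMeasurable
    · have : ‖φ x‖ ≤ C * (1 + ‖x‖ ^ 2)⁻¹ := by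
        rw [← div_eq_mul_inv, le_div_iff₀ (by positivity), mul_comm]
        exact hC x
      rw [Real.norm_of_nonneg (by positivity)]
      calc _ ≤ (‖x‖ ^ 2)⁻¹ * (C * (1 + ‖x‖ ^ 2)⁻¹) := by gcongr
        _ = _ := by ring
  refine (hφ.add h2).congr (Eventually.of_forall fun x => ?_)
  simp [add_mul]

theorem aestronglyMeasurable_of_continuousOn_compl_zero {F : Type*} [NormedAddCommGroup F]
    {f : R3 → F} (hf : ContinuousOn f {0}ᶜ) : AEStronglyMeasurable f volume := by
  have := hf.aestronglyMeasurable (μ := volume) (measurableSet_singleton (0 : R3)).compl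
  rwa [restrict_compl_singleton] at this

theorem integrable_mul_schwartz_of_bound {f : R3 → ℂ} (hf : ContinuousOn f {0}ᶜ) {C : ℝ}
    (hb : ∀ x : R3, x ≠ 0 → ‖f x‖ ≤ C * (1 + (‖x‖ ^ 2)⁻¹)) (φ : 𝓢(R3, ℂ)) :
    Integrable (fun x => f x * φ x) := by
  refine ((integrable_one_add_inv_norm_sq_mul_schwartz φ).const_mul C).mono'
    ((aestronglyMeasurable_of_continuousOn_compl_zero hf).mul φ.continuous.aestronglyMeasurable) ?_
  have h0 : ∀ᵐ x : R3, x ≠ 0 := by simp [ae_iff]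
  filter_upwards [h0] with x hx
  rw [norm_mul, ← mul_assoc]
  gcongr
  exact hb x hx


theorem hasDerivAt_norm_line {x v : R3} (hx : x ≠ 0) :
    HasDerivAt (fun t : ℝ => ‖x + t • v‖) (inner ℝ x v / ‖x‖) 0 := by
  have h1 : HasDerivAt (fun t : ℝ => x + t • v) v 0 := by
    simpa using ((hasDerivAt_id (0 : ℝ)).smul_const v).const_add x
  have h2 := h1.norm_sq.sqrt (by simpa using hx)
  simp only [zero_smul, add_zero, Real.sqrt_sq (norm_nonneg _)] at h2
  refine h2.congr_deriv ?_
  field_simp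

theorem hasDerivAt_inner_line (x v : R3) :
    HasDerivAt (fun t : ℝ => inner ℝ (x + t • v) v) (inner ℝ v v) 0 := by
  simp only [inner_add_left, inner_smul_left]
  simpa using ((hasDerivAt_id (0 : ℝ)).mul_const (inner ℝ v v)).const_add (inner ℝ x v)

theorem abs_inner_mul_le {a : ℝ} {x v : R3} (hv : ‖v‖ = 1) :
    |a * inner ℝ x v| ≤ |a| * ‖x‖ := by
  rw [abs_mul]
  have := abs_real_inner_le_norm x v
  rw [hv, mul_one] at this
  gcongr

/-- The second directional derivative of a radial function, in the weak sense. -/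
theorem integral_radial_mul_lineDeriv_lineDeriv {ρ ρ₁ ρ₂ : ℝ → ℝ} {C : ℝ}
    (h1 : ∀ r, 0 < r → HasDerivAt ρ (ρ₁ r) r) (h2 : ∀ r, 0 < r → HasDerivAt ρ₁ (ρ₂ r) r)
    (hc : ContinuousOn ρ₂ (Set.Ioi 0))
    (b0 : ∀ r, 0 < r → |ρ r| ≤ C * (1 + (r ^ 2)⁻¹)) (b1 : ∀ r, 0 < r → |ρ₁ r| ≤ C * (1 + (r ^ 2)⁻¹))
    (b1' : ∀ r, 0 < r → |ρ₁ r / r| ≤ C * (1 + (r ^ 2)⁻¹))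
    (b2 : ∀ r, 0 < r → |ρ₂ r| ≤ C * (1 + (r ^ 2)⁻¹)) {v : R3} (hv : ‖v‖ = 1) (φ : 𝓢(R3, ℂ)) :
    Integrable (fun x : R3 => (((ρ₂ ‖x‖ - ρ₁ ‖x‖ / ‖x‖) / ‖x‖ ^ 2 * inner ℝ x v ^ 2
      + ρ₁ ‖x‖ / ‖x‖ : ℝ) : ℂ) * φ x) ∧
    ∫ x : R3, (ρ ‖x‖ : ℂ) * (LineDeriv.lineDerivOp v (LineDeriv.lineDerivOp v φ)) x =
      ∫ x : R3, (((ρ₂ ‖x‖ - ρ₁ ‖x‖ / ‖x‖) / ‖x‖ ^ 2 * inner ℝ x v ^ 2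
      + ρ₁ ‖x‖ / ‖x‖ : ℝ) : ℂ) * φ x := by
  have hv0 : v ≠ 0 := by
    rintro rfl
    simp at hv
  have hn : ContinuousOn (fun x : R3 => ‖x‖) {0}ᶜ := continuous_norm.continuousOn
  have hm : Set.MapsTo (fun x : R3 => ‖x‖) {0}ᶜ (Set.Ioi 0) := fun x hx => norm_pos_iff.mpr hx
  have c0 : ContinuousOn (fun x : R3 => ρ ‖x‖) {0}ᶜ :=
    ContinuousOn.comp (g := ρ) (fun r hr => (h1 r hr).continuousAt.continuousWithinAt) hn hm
  have c1 : ContinuousOn (fun x : R3 => ρ₁ ‖x‖) {0}ᶜ :=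
    ContinuousOn.comp (g := ρ₁) (fun r hr => (h2 r hr).continuousAt.continuousWithinAt) hn hm
  have c2 : ContinuousOn (fun x : R3 => ρ₂ ‖x‖) {0}ᶜ := hc.comp hn hm
  have ci : ContinuousOn (fun x : R3 => (inner ℝ x v : ℝ)) {0}ᶜ := by fun_prop
  have hne : ∀ x ∈ ({0}ᶜ : Set R3), ‖x‖ ≠ 0 := fun x hx => norm_ne_zero_iff.mpr hx
  have e1 : ContinuousOn (fun x : R3 => ρ₁ ‖x‖ / ‖x‖) {0}ᶜ := c1.div hn hne
  have d1 : ContinuousOn (fun x : R3 => ρ₁ ‖x‖ / ‖x‖ * (inner ℝ x v : ℝ)) {0}ᶜ := e1.mul ci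
  have d2 : ContinuousOn (fun x : R3 => (ρ₂ ‖x‖ - ρ₁ ‖x‖ / ‖x‖) / ‖x‖ ^ 2 * inner ℝ x v ^ 2
      + ρ₁ ‖x‖ / ‖x‖) {0}ᶜ :=
    (((c2.sub e1).div (hn.pow 2) fun x hx => pow_ne_zero 2 (hne x hx)).mul (ci.pow 2)).add e1
  have I0 := fun ψ : 𝓢(R3, ℂ) => integrable_mul_schwartz_of_bound
    (f := fun x => (ρ ‖x‖ : ℂ)) (Complex.continuous_ofReal.comp_continuousOn c0) (C := C)
    (fun x hx => by
      rw [Complex.norm_real]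
      exact b0 _ (norm_pos_iff.mpr hx)) ψ
  have I1 := fun ψ : 𝓢(R3, ℂ) => integrable_mul_schwartz_of_bound
    (f := fun x => ((ρ₁ ‖x‖ / ‖x‖ * (inner ℝ x v : ℝ) : ℝ) : ℂ))
    (Complex.continuous_ofReal.comp_continuousOn d1) (C := C)
    (fun x hx => by
      have hp := norm_pos_iff.mpr hx
      rw [Complex.norm_real]
      refine (abs_inner_mul_le hv).trans ?_
      rw [abs_div, abs_of_pos hp, div_mul_cancel₀ _ hp.ne']
      exact b1 _ hp) ψ
  -- Since (x·v)² ≤ |x|², the first term is at most |ρ₂| + |ρ₁/r|, and the second adds |ρ₁/r| once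
  -- more; hence `3 * C`.
  have I2 := fun ψ : 𝓢(R3, ℂ) => integrable_mul_schwartz_of_bound
    (f := fun x => (((ρ₂ ‖x‖ - ρ₁ ‖x‖ / ‖x‖) / ‖x‖ ^ 2 * inner ℝ x v ^ 2
      + ρ₁ ‖x‖ / ‖x‖ : ℝ) : ℂ))
    (Complex.continuous_ofReal.comp_continuousOn d2) (C := 3 * C)
    (fun x hx => by
      have hp := norm_pos_iff.mpr hx
      rw [Complex.norm_real, Real.norm_eq_abs]
      have k1 := b1' _ hp
      have k2 := b2 _ hp
      have k3 : |(ρ₂ ‖x‖ - ρ₁ ‖x‖ / ‖x‖) / ‖x‖ ^ 2 * inner ℝ x v ^ 2| ≤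
          |ρ₂ ‖x‖ - ρ₁ ‖x‖ / ‖x‖| := by
        have h := abs_real_inner_le_norm x v
        rw [hv, mul_one] at h
        rw [abs_mul, abs_div, abs_pow, abs_pow, abs_of_pos hp, div_mul_eq_mul_div,
          div_le_iff₀ (by positivity)]
        gcongr
      have k4 := abs_sub (ρ₂ ‖x‖) (ρ₁ ‖x‖ / ‖x‖)
      have k5 := abs_add_le ((ρ₂ ‖x‖ - ρ₁ ‖x‖ / ‖x‖) / ‖x‖ ^ 2 * inner ℝ x v ^ 2) (ρ₁ ‖x‖ / ‖x‖)
      linarith) ψ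
  refine ⟨I2 φ, ?_⟩
  have hφ : ∀ (ψ : 𝓢(R3, ℂ)) (x : R3),
      HasDerivAt (fun t : ℝ => ψ (x + t • v)) ((LineDeriv.lineDerivOp v ψ) x) 0 := by
    intro ψ x
    have := (ψ.differentiableAt (x := x)).hasFDerivAt.hasLineDerivAt v
    rw [SchwartzMap.lineDerivOp_apply_eq_fderiv]
    exact this
  have hx0 : ∀ x : R3, (∀ t : ℝ, x + t • v ≠ 0) → x ≠ 0 := fun x hx => by simpa using hx 0
  have D1 : ∀ x : R3, (∀ t : ℝ, x + t • v ≠ 0) →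
      HasDerivAt (fun t : ℝ => ρ ‖x + t • v‖) (ρ₁ ‖x‖ / ‖x‖ * inner ℝ x v) 0 := by
    intro x hx
    have h := HasDerivAt.comp_of_eq (h₂ := ρ) (0 : ℝ) (h1 _ (norm_pos_iff.mpr (hx0 x hx)))
      (hasDerivAt_norm_line (v := v) (hx0 x hx)) (by simp)
    exact h.congr_deriv (by ring)
  have D2 : ∀ x : R3, (∀ t : ℝ, x + t • v ≠ 0) →
      HasDerivAt (fun t : ℝ => ρ₁ ‖x + t • v‖ / ‖x + t • v‖ * inner ℝ (x + t • v) v)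
      ((ρ₂ ‖x‖ - ρ₁ ‖x‖ / ‖x‖) / ‖x‖ ^ 2 * inner ℝ x v ^ 2 + ρ₁ ‖x‖ / ‖x‖) 0 := by
    intro x hx
    have hp := norm_pos_iff.mpr (hx0 x hx)
    have hN := hasDerivAt_norm_line (v := v) (hx0 x hx)
    have h := HasDerivAt.comp_of_eq (h₂ := ρ₁) (0 : ℝ) (h2 _ hp) hN (by simp)
    have h3 := (h.div hN (by simpa using hp.ne')).mul (hasDerivAt_inner_line x v)
    refine h3.congr_deriv ?_
    simp only [Function.comp, zero_smul, add_zero, real_inner_self_eq_norm_sq, hv, Pi.div_apply]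
    field_simp
  rw [integral_mul_eq_neg_of_hasDerivAt_line hv0 (I1 _) (I0 _) (I0 _)
    (fun x hx => (D1 x hx).ofReal_comp) (hφ _),
    integral_mul_eq_neg_of_hasDerivAt_line hv0 (I2 _) (I1 _) (I1 _)
    (fun x hx => (D2 x hx).ofReal_comp) (hφ _), neg_neg]

/-- The weak Laplacian of a radial function. -/
theorem integral_radial_mul_laplacian {χ χ₁ χ₂ : ℝ → ℝ} {C : ℝ}
    (h1 : ∀ r, 0 < r → HasDerivAt χ (χ₁ r) r) (h2 : ∀ r, 0 < r → HasDerivAt χ₁ (χ₂ r) r)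
    (hc : ContinuousOn χ₂ (Set.Ioi 0)) (b0 : ∀ r, 0 < r → |χ r| ≤ C * r)
    (b1 : ∀ r, 0 < r → |χ₁ r| ≤ C) (b2 : ∀ r, 0 < r → |χ₂ r| ≤ C) (φ : 𝓢(R3, ℂ)) :
    ∫ x : R3, ((χ ‖x‖ / ‖x‖ : ℝ) : ℂ) * (Δ φ) x = ∫ x : R3, ((χ₂ ‖x‖ / ‖x‖ : ℝ) : ℂ) * φ x := by
  have hC : 0 ≤ C := (abs_nonneg _).trans (b1 1 one_pos)
  -- Linear vanishing of χ makes χ/r bounded; a nonzero χ(0) would produce a delta at the origin.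
  have a0 : ∀ r, 0 < r → |χ r / r| ≤ C := fun r hr => by
    rw [abs_div, abs_of_pos hr, div_le_iff₀ hr]
    exact b0 r hr
  have hr1 : ∀ r : ℝ, 0 < r → r⁻¹ ≤ 1 + (r ^ 2)⁻¹ := fun r hr => by
    rw [← inv_pow]
    nlinarith [sq_nonneg (r⁻¹ - 1)]
  have hr0 : ∀ r : ℝ, 0 < r → 1 ≤ 1 + (r ^ 2)⁻¹ := fun r hr => by
    have : 0 < (r ^ 2)⁻¹ := by positivity
    linarith
  have hr2 : ∀ r : ℝ, 0 < r → r⁻¹ * r⁻¹ ≤ 1 + (r ^ 2)⁻¹ := fun r hr => by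
    rw [← inv_pow]
    nlinarith
  have p1 : ∀ r, 0 < r → |χ₁ r / r - χ r / r / r| ≤ 2 * C * r⁻¹ := fun r hr => by
    rw [← sub_div, abs_div, abs_of_pos hr, div_eq_mul_inv]
    gcongr
    have := abs_sub (χ₁ r) (χ r / r)
    linarith [a0 r hr, b1 r hr]
  have p1' : ∀ r, 0 < r → |(χ₁ r / r - χ r / r / r) / r| ≤ 2 * C * (1 + (r ^ 2)⁻¹) := fun r hr => by
    rw [abs_div, abs_of_pos hr, div_eq_mul_inv]
    calc _ ≤ 2 * C * r⁻¹ * r⁻¹ := by gcongr; exact p1 r hr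
      _ = 2 * C * (r⁻¹ * r⁻¹) := by ring
      _ ≤ _ := by gcongr; exact hr2 r hr
  -- For ρ = χ/r one has ρ' = χ'/r - χ/r² and ρ'' = χ''/r - 2ρ'/r. The bounds are 2C for ρ' and
  -- ρ'/r, hence C + 2·2C for ρ''; `5 * C` covers all of them.
  have key := fun v (hv : ‖v‖ = 1) => integral_radial_mul_lineDeriv_lineDeriv (C := 5 * C)
    (ρ := fun r => χ r / r) (ρ₁ := fun r => χ₁ r / r - χ r / r / r)
    (ρ₂ := fun r => χ₂ r / r - 2 * ((χ₁ r / r - χ r / r / r) / r))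
    (fun r hr => ((h1 r hr).div (hasDerivAt_id r) hr.ne').congr_deriv (by simp [field]))
    (fun r hr => (((h2 r hr).div (hasDerivAt_id r) hr.ne').sub
      (((h1 r hr).div (hasDerivAt_id r) hr.ne').div (hasDerivAt_id r) hr.ne')).congr_deriv (by
        simp; field_simp; ring))
    (by
      have c0 : ContinuousOn χ (Set.Ioi 0) :=
        fun r hr => (h1 r hr).continuousAt.continuousWithinAt
      have c1 : ContinuousOn χ₁ (Set.Ioi 0) :=
        fun r hr => (h2 r hr).continuousAt.continuousWithinAt
      have hne : ∀ r ∈ Set.Ioi (0 : ℝ), r ≠ 0 := fun r hr => (Set.mem_Ioi.mp hr).ne'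
      exact (hc.div continuousOn_id hne).sub (continuousOn_const.mul
        (((c1.div continuousOn_id hne).sub ((c0.div continuousOn_id hne).div
          continuousOn_id hne)).div continuousOn_id hne)))
    (fun r hr => by
      have := hr0 r hr
      nlinarith [a0 r hr])
    (fun r hr => by
      have := hr1 r hr
      nlinarith [p1 r hr, inv_pos.mpr hr])
    (fun r hr => by
      nlinarith [p1' r hr, hr0 r hr])
    (fun r hr => by
      have k1 : |χ₂ r / r| ≤ C * (1 + (r ^ 2)⁻¹) := by
        rw [abs_div, abs_of_pos hr, div_eq_mul_inv]
        gcongr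
        · exact b2 r hr
        · exact hr1 r hr
      have k2 := p1' r hr
      have k3 := abs_sub (χ₂ r / r) (2 * ((χ₁ r / r - χ r / r / r) / r))
      rw [abs_mul 2, abs_two] at k3
      linarith) hv φ
  let b := EuclideanSpace.basisFun (Fin 3) ℝ
  have hb : ∀ i, ‖b i‖ = 1 := fun i => b.norm_eq_one i
  have hI : ∀ i, Integrable (fun x : R3 => ((χ ‖x‖ / ‖x‖ : ℝ) : ℂ) *
      (LineDeriv.lineDerivOp (b i) (LineDeriv.lineDerivOp (b i) φ)) x) := fun i =>
    integrable_mul_schwartz_of_bound (C := C) (Complex.continuous_ofReal.comp_continuousOn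
      ((ContinuousOn.comp (g := χ) (fun r hr => (h1 r hr).continuousAt.continuousWithinAt)
        continuous_norm.continuousOn (fun x hx => norm_pos_iff.mpr hx)).div
        continuous_norm.continuousOn fun x hx => norm_ne_zero_iff.mpr hx))
      (fun x hx => by
        have hp := norm_pos_iff.mpr hx
        have h : ‖((χ ‖x‖ / ‖x‖ : ℝ) : ℂ)‖ ≤ C * (1 + (‖x‖ ^ 2)⁻¹) := by
          rw [Complex.norm_real, Real.norm_eq_abs]
          nlinarith [a0 _ hp, hr0 _ hp]
        exact h) _
  have hsum : ∀ x : R3, ∑ i, (inner ℝ x (b i)) ^ 2 = ‖x‖ ^ 2 := fun x => b.sum_sq_inner_left x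
  simp_rw [SchwartzMap.laplacian_eq_sum b, sum_apply, Finset.mul_sum]
  rw [integral_finsetSum _ (fun i _ => hI i)]
  rw [Finset.sum_congr rfl fun i _ => (key (b i) (hb i)).2,
    ← integral_finsetSum _ (fun i _ => (key (b i) (hb i)).1)]
  refine integral_congr_ae ?_
  have h0 : ∀ᵐ x : R3, x ≠ 0 := by simp [ae_iff]
  filter_upwards [h0] with x hx
  have hp := norm_pos_iff.mpr hx
  -- Summed over an orthonormal basis, the integrand is (ρ'' - ρ'/r) + 3ρ'/r = ρ'' + 2ρ'/r = χ''/r.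
  rw [← Finset.sum_mul, ← Complex.ofReal_sum, Finset.sum_add_distrib, ← Finset.mul_sum, hsum]
  congr 2
  simp only [Finset.sum_const, Finset.card_univ, Fintype.card_fin, nsmul_eq_mul]
  push_cast
  field_simp
  ring

/-! ### The Laplacian on `L²` -/

theorem fourierMultiplier_one_add_mul_norm_sq (c : ℝ) (f : 𝓢'(R3, ℂ)) :
    TemperedDistribution.fourierMultiplierCLM ℂ
      (fun x : R3 => Complex.ofReal (1 + c * ‖x‖ ^ 2)) f =
    f - ((c * ((2 * Real.pi) ^ 2)⁻¹ : ℝ) : ℂ) • Δ f := by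
  have h1 : TemperedDistribution.fourierMultiplierCLM ℂ
      (fun x : R3 => Complex.ofReal (1 + c * ‖x‖ ^ 2)) f =
      TemperedDistribution.fourierMultiplierCLM ℂ (fun x : R3 => (1 : ℂ)) f +
      TemperedDistribution.fourierMultiplierCLM ℂ
        ((c : ℂ) • fun x : R3 => Complex.ofReal (‖x‖ ^ 2)) f := by
    simp only [TemperedDistribution.fourierMultiplierCLM_apply]
    rw [← FourierTransform.fourierInv_add, ← add_apply,
      ← TemperedDistribution.smulLeftCLM_add (by fun_prop) (by fun_prop)]
    congr 3
    ext x
    simp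
  rw [h1, TemperedDistribution.laplacian_eq_fourierMultiplierCLM,
    TemperedDistribution.fourierMultiplierCLM_smul (by fun_prop)]
  simp only [TemperedDistribution.fourierMultiplierCLM_const, smul_apply]
  rw [← Complex.coe_smul, smul_smul]
  have : (((c * ((2 * Real.pi) ^ 2)⁻¹ : ℝ) : ℂ) * ((-(2 * Real.pi) ^ 2 : ℝ) : ℂ)) = -(c : ℂ) := by
    rw [← Complex.ofReal_mul, ← Complex.ofReal_neg]
    have := Real.pi_ne_zero
    congr 1
    field_simp
  rw [this]
  simp

/-- The Bessel potential of order 2 is 1 - (2π)⁻²Δ, so an L² Laplacian already gives membership in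
H²; no first derivatives are needed. -/
theorem memH2_of_laplacian {u w : L2} (h : Δ (toDist u) = toDist w) : MemH2 u := by
  have hb : TemperedDistribution.besselPotential R3 ℂ 2 (toDist u) =
      toDist u - ((1 * ((2 * Real.pi) ^ 2)⁻¹ : ℝ) : ℂ) • Δ (toDist u) := by
    rw [← fourierMultiplier_one_add_mul_norm_sq, TemperedDistribution.besselPotential]
    congr 2
    ext x
    simp
  refine ⟨u - ((1 * ((2 * Real.pi) ^ 2)⁻¹ : ℝ) : ℂ) • w, ?_⟩
  rw [hb, h, ← map_smul, ← map_sub]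
  rfl

/-- The operator 1 - c⁻¹Δ is the Fourier multiplier with symbol 1 + (2π)²|ξ|²/c. The reciprocal
symbol also has temperate growth, so the operator is injective on tempered distributions. -/
theorem eq_zero_of_laplacian_eq_smul {w : L2} {c : ℝ} (hc : 0 < c)
    (h : Δ (toDist w) = (c : ℂ) • toDist w) : w = 0 := by
  apply toDist_injective
  rw [map_zero]
  generalize toDist w = f at h
  -- This dilation carries the temperate growth of (1 + |x|²)⁻¹ over to the reciprocal symbol.
  let A : R3 →L[ℝ] R3 := (2 * Real.pi / Real.sqrt c) • ContinuousLinearMap.id ℝ R3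
  have hA : ∀ x, ‖A x‖ ^ 2 = (2 * Real.pi) ^ 2 / c * ‖x‖ ^ 2 := by
    intro x
    simp [A, norm_smul, mul_pow, div_pow, Real.sq_sqrt hc.le]
  have g1 : (fun x : R3 => Complex.ofReal (1 + (2 * Real.pi) ^ 2 / c * ‖x‖ ^ 2)).HasTemperateGrowth :=
    by fun_prop
  have g2 : (fun x : R3 => Complex.ofReal
      ((1 + (2 * Real.pi) ^ 2 / c * ‖x‖ ^ 2) ^ (-1 : ℝ))).HasTemperateGrowth := by
    have := (Function.hasTemperateGrowth_one_add_norm_sq_rpow R3 (-1)).comp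
      (A.hasTemperateGrowth)
    simp only [Function.comp_def, hA] at this
    exact Function.Complex.hasTemperateGrowth_ofReal.comp this
  have h1 := fourierMultiplier_one_add_mul_norm_sq ((2 * Real.pi) ^ 2 / c) f
  have h2 : (2 * Real.pi) ^ 2 / c * ((2 * Real.pi) ^ 2)⁻¹ = c⁻¹ := by
    have := Real.pi_ne_zero
    field_simp
  have h3 : ((c⁻¹ : ℝ) : ℂ) * c = 1 := by
    rw [← Complex.ofReal_mul, inv_mul_cancel₀ hc.ne', Complex.ofReal_one]
  rw [h2, h, smul_smul, h3, one_smul, sub_self] at h1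
  have h4 := TemperedDistribution.fourierMultiplierCLM_fourierMultiplierCLM_apply (F := ℂ) g1 g2 f
  rw [h1, map_zero] at h4
  have h5 : ((fun x : R3 => Complex.ofReal (1 + (2 * Real.pi) ^ 2 / c * ‖x‖ ^ 2)) *
      fun x : R3 => Complex.ofReal ((1 + (2 * Real.pi) ^ 2 / c * ‖x‖ ^ 2) ^ (-1 : ℝ))) =
      fun _ => 1 := by
    ext x
    have : 1 + (2 * Real.pi) ^ 2 / c * ‖x‖ ^ 2 ≠ 0 := by positivity
    rw [Pi.mul_apply, ← Complex.ofReal_mul, Real.rpow_neg_one, mul_inv_cancel₀ this]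
    simp
  rw [h5, TemperedDistribution.fourierMultiplierCLM_const] at h4
  simpa using h4.symm

/-- The translate `x ↦ φ (x + a)` of a Schwartz function. -/
def schwartzTranslate (a : R3) (φ : 𝓢(R3, ℂ)) : 𝓢(R3, ℂ) := φ.compSubConstCLM ℂ (-a)

theorem schwartzTranslate_apply (a : R3) (φ : 𝓢(R3, ℂ)) (x : R3) :
    schwartzTranslate a φ x = φ (x + a) := by
  rw [schwartzTranslate, SchwartzMap.compSubConstCLM_apply, sub_neg_eq_add]

theorem laplacian_schwartzTranslate (a : R3) (φ : 𝓢(R3, ℂ)) (x : R3) :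
    (Δ (schwartzTranslate a φ)) x = (Δ φ) (x + a) := by
  have h : ∀ (v : R3) (ψ : 𝓢(R3, ℂ)), LineDeriv.lineDerivOp v (schwartzTranslate a ψ) =
      schwartzTranslate a (LineDeriv.lineDerivOp v ψ) := by
    intro v ψ
    ext x
    rw [schwartzTranslate_apply, SchwartzMap.lineDerivOp_apply_eq_fderiv,
      SchwartzMap.lineDerivOp_apply_eq_fderiv]
    have : (schwartzTranslate a ψ : R3 → ℂ) = fun x => ψ (x + a) :=
      funext (schwartzTranslate_apply a ψ)
    rw [this, fderiv_comp_add_right]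
  rw [SchwartzMap.laplacian_eq_sum (EuclideanSpace.basisFun (Fin 3) ℝ),
    SchwartzMap.laplacian_eq_sum (EuclideanSpace.basisFun (Fin 3) ℝ)]
  simp only [h, sum_apply, schwartzTranslate_apply]

/-- `(χ(|x|)/|x|)` is square integrable when `χ` is. -/
theorem memLp_radial {χ : ℝ → ℝ} (hc : ContinuousOn χ (Set.Ioi 0))
    (hi : IntegrableOn (fun r => χ r ^ 2) (Set.Ioi 0)) :
    MemLp (fun x : R3 => ((χ ‖x‖ / ‖x‖ : ℝ) : ℂ)) 2 := by
  have hm : AEStronglyMeasurable (fun x : R3 => ((χ ‖x‖ / ‖x‖ : ℝ) : ℂ)) :=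
    aestronglyMeasurable_of_continuousOn_compl_zero (Complex.continuous_ofReal.comp_continuousOn
      ((ContinuousOn.comp (g := χ) hc
        continuous_norm.continuousOn (fun x hx => norm_pos_iff.mpr hx)).div
        continuous_norm.continuousOn fun x hx => norm_ne_zero_iff.mpr hx))
  rw [memLp_two_iff_integrable_sq_norm hm]
  simp only [Complex.norm_real, Real.norm_eq_abs, sq_abs]
  refine (integrable_fun_norm_addHaar (volume : Measure R3)
    (f := fun r : ℝ => (χ r / r) ^ 2)).mpr (hi.congr_fun ?_ measurableSet_Ioi)
  intro r hr
  have : r ≠ 0 := (Set.mem_Ioi.mp hr).ne'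
  simp [field]

/-- Translation invariance of the measure moves the centre `a` onto the test function. The case a =
±y/2 serves the Green's functions, and a = 0 the slow Hamiltonian. -/
theorem laplacian_toDist_radial {χ χ₁ χ₂ : ℝ → ℝ} {C : ℝ}
    (h1 : ∀ r, 0 < r → HasDerivAt χ (χ₁ r) r) (h2 : ∀ r, 0 < r → HasDerivAt χ₁ (χ₂ r) r)
    (hc : ContinuousOn χ₂ (Set.Ioi 0)) (b0 : ∀ r, 0 < r → |χ r| ≤ C * r)
    (b1 : ∀ r, 0 < r → |χ₁ r| ≤ C) (b2 : ∀ r, 0 < r → |χ₂ r| ≤ C) {u w : L2} (a : R3)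
    (hu : u =ᵐ[volume] fun x => ((χ ‖x - a‖ / ‖x - a‖ : ℝ) : ℂ))
    (hw : w =ᵐ[volume] fun x => ((χ₂ ‖x - a‖ / ‖x - a‖ : ℝ) : ℂ)) :
    Δ (toDist u) = toDist w := by
  ext φ
  rw [TemperedDistribution.laplacian_apply_apply, Lp.toTemperedDistributionCLM_apply,
    Lp.toTemperedDistributionCLM_apply, Lp.toTemperedDistribution_apply,
    Lp.toTemperedDistribution_apply]
  have key := integral_radial_mul_laplacian h1 h2 hc b0 b1 b2 (schwartzTranslate a φ)
  simp only [laplacian_schwartzTranslate, schwartzTranslate_apply] at key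
  calc ∫ x, (Δ φ) x • u x = ∫ x, ((χ ‖x - a‖ / ‖x - a‖ : ℝ) : ℂ) * (Δ φ) (x - a + a) := by
        refine integral_congr_ae ?_
        filter_upwards [hu] with x hx
        rw [hx, sub_add_cancel, smul_eq_mul, mul_comm]
    _ = ∫ x : R3, ((χ ‖x‖ / ‖x‖ : ℝ) : ℂ) * (Δ φ) (x + a) :=
        integral_sub_right_eq_self (fun x : R3 => ((χ ‖x‖ / ‖x‖ : ℝ) : ℂ) * (Δ φ) (x + a)) a
    _ = ∫ x : R3, ((χ₂ ‖x‖ / ‖x‖ : ℝ) : ℂ) * φ (x + a) := key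
    _ = ∫ x, ((χ₂ ‖x - a‖ / ‖x - a‖ : ℝ) : ℂ) * φ (x - a + a) :=
        (integral_sub_right_eq_self (fun x : R3 => ((χ₂ ‖x‖ / ‖x‖ : ℝ) : ℂ) * φ (x + a)) a).symm
    _ = ∫ x, φ x • w x := by
        refine integral_congr_ae ?_
        filter_upwards [hw] with x hx
        rw [hx, sub_add_cancel, smul_eq_mul, mul_comm]

/-! ### The effective potential -/

theorem exists_mul_exp_eq {x : ℝ} (hx : 0 ≤ x) : ∃ s ∈ Set.Ici (-1 : ℝ), s * Real.exp s = x := by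
  have hc : ContinuousOn (fun s : ℝ => s * Real.exp s) (Set.Icc 0 x) := by fun_prop
  have h := intermediate_value_Icc hx hc
  have hm : x ∈ Set.Icc ((fun s : ℝ => s * Real.exp s) 0) ((fun s : ℝ => s * Real.exp s) x) := by
    constructor
    · simpa using hx
    · exact le_mul_of_one_le_right hx (Real.one_le_exp hx)
  obtain ⟨s, hs, h2⟩ := h hm
  exact ⟨s, by have := hs.1; simp; linarith, h2⟩

theorem lambertW_mul_exp {x : ℝ} (hx : 0 ≤ x) : lambertW x * Real.exp (lambertW x) = x :=
  Function.invFunOn_eq (f := fun s : ℝ => s * Real.exp s) (exists_mul_exp_eq hx)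

/-- `W(exp a) - a`, the inverse function of `s ↦ exp (-s) - s`. -/
def lambertGap (a : ℝ) : ℝ := lambertW (Real.exp a) - a

/-- From W e^W = e^a follows W = e^{a - W}. This links the Lambert function to the condition e^{-s}
- s = θ that selects the eigenvalues of h(y). -/
theorem exp_neg_lambertGap_sub (a : ℝ) : Real.exp (-lambertGap a) - lambertGap a = a := by
  have h := lambertW_mul_exp (Real.exp_pos a).le
  have h2 : Real.exp (-lambertGap a) = lambertW (Real.exp a) := by
    rw [lambertGap, neg_sub, Real.exp_sub]
    nth_rewrite 1 [← h]
    field_simp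
  rw [h2, lambertGap]
  ring

theorem strictAnti_exp_neg_sub : StrictAnti fun s : ℝ => Real.exp (-s) - s := by
  intro s t h
  have := Real.exp_lt_exp.mpr (neg_lt_neg h)
  simp only
  linarith

theorem lambertGap_eq_iff (a s : ℝ) : lambertGap a = s ↔ Real.exp (-s) - s = a := by
  constructor
  · rintro rfl
    exact exp_neg_lambertGap_sub a
  · intro h
    refine strictAnti_exp_neg_sub.injective ?_
    simp only [exp_neg_lambertGap_sub, h]

theorem effPotential_eq (ν : ℝ) (θ : ℝ → ℝ) (r : ℝ) :
    effPotential ν θ r = -(lambertGap (θ r) ^ 2 / (ν * r ^ 2)) := rfl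

theorem lambertGap_pos {a : ℝ} (ha : a < 1) : 0 < lambertGap a := by
  refine strictAnti_exp_neg_sub.lt_iff_gt.mp ?_
  simpa [exp_neg_lambertGap_sub] using ha

/-! ### Green's functions -/

theorem memLp_green {ν l : ℝ} (hν : 0 < ν) (hl : 0 < l) (a : R3) :
    MemLp (fun x : R3 => (green ν l (x - a) : ℂ)) 2 := by
  have hk : 0 < Real.sqrt (l * ν) := Real.sqrt_pos.mpr (by positivity)
  have h := memLp_radial (χ := fun r => Real.exp (-(Real.sqrt (l * ν) * r))) (by fun_prop) (by
    have := exp_neg_integrableOn_Ioi 0 (b := 2 * Real.sqrt (l * ν)) (by positivity)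
    refine this.congr_fun (fun r _ => ?_) measurableSet_Ioi
    simp only
    rw [← Real.exp_nat_mul]
    congr 1
    push_cast
    ring)
  exact h.comp_measurePreserving (measurePreserving_sub_right volume a)

/-- The `L²` function `G^l(· - a)`; it is `0` when `l` or `ν` is not positive. -/
def greenLp (ν l : ℝ) (a : R3) : L2 :=
  open Classical in
  if h : 0 < ν ∧ 0 < l then (memLp_green h.1 h.2 a).toLp _ else 0

theorem coeFn_greenLp {ν l : ℝ} (hν : 0 < ν) (hl : 0 < l) (a : R3) :
    greenLp ν l a =ᵐ[volume] fun x : R3 => (green ν l (x - a) : ℂ) := by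
  rw [greenLp, dif_pos ⟨hν, hl⟩]
  exact MemLp.coeFn_toLp _

/-- Both Green's functions carry the same delta at `a`, so it cancels in the difference: the radial
profile e^{-k'r} - e^{-kr} vanishes linearly at 0. -/
theorem laplacian_greenLp_sub {ν l l' : ℝ} (hν : 0 < ν) (hl : 0 < l) (hl' : 0 < l') (a : R3) :
    Δ (toDist (greenLp ν l' a - greenLp ν l a)) =
      toDist (((l' * ν : ℝ) : ℂ) • greenLp ν l' a - ((l * ν : ℝ) : ℂ) • greenLp ν l a) := by
  obtain ⟨k, hk⟩ : ∃ k, k = Real.sqrt (l * ν) := ⟨_, rfl⟩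
  obtain ⟨k', hk'⟩ : ∃ k', k' = Real.sqrt (l' * ν) := ⟨_, rfl⟩
  have k0 : 0 ≤ k := hk ▸ Real.sqrt_nonneg _
  have k0' : 0 ≤ k' := hk' ▸ Real.sqrt_nonneg _
  have e : l * ν = k ^ 2 := by rw [hk, Real.sq_sqrt (by positivity)]
  have e' : l' * ν = k' ^ 2 := by rw [hk', Real.sq_sqrt (by positivity)]
  have hd : ∀ k r : ℝ, HasDerivAt (fun r => Real.exp (-(k * r))) (-k * Real.exp (-(k * r))) r := by
    intro k r
    have := ((hasDerivAt_id r).const_mul k).neg.exp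
    exact this.congr_deriv (by simp [mul_comm])
  have hE : ∀ k r : ℝ, 0 ≤ k → 0 < r → 0 < Real.exp (-(k * r)) ∧ Real.exp (-(k * r)) ≤ 1 :=
    fun k r hk hr => ⟨Real.exp_pos _, Real.exp_le_one_iff.mpr (by nlinarith)⟩
  -- The profile is bounded by (k + k')r, its first derivative by k + k', and its second by k² +
  -- k'².
  refine laplacian_toDist_radial (C := k + k' + (k ^ 2 + k' ^ 2))
    (χ := fun r => Real.exp (-(k' * r)) - Real.exp (-(k * r)))
    (χ₁ := fun r => -k' * Real.exp (-(k' * r)) - -k * Real.exp (-(k * r)))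
    (χ₂ := fun r => k' ^ 2 * Real.exp (-(k' * r)) - k ^ 2 * Real.exp (-(k * r)))
    (fun r _ => (hd k' r).sub (hd k r))
    (fun r _ => (((hd k' r).const_mul (-k')).sub ((hd k r).const_mul (-k))).congr_deriv (by ring))
    (by fun_prop) (fun r hr => ?_) (fun r hr => ?_) (fun r hr => ?_) a ?_ ?_
  · have a1 := Real.add_one_le_exp (-(k * r))
    have a2 := Real.add_one_le_exp (-(k' * r))
    have a3 := hE k r k0 hr
    have a4 := hE k' r k0' hr
    rw [abs_le]
    constructor <;> nlinarith [mul_nonneg k0 hr.le, mul_nonneg k0' hr.le,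
      mul_nonneg (sq_nonneg k) hr.le, mul_nonneg (sq_nonneg k') hr.le]
  · have a3 := hE k r k0 hr
    have a4 := hE k' r k0' hr
    rw [abs_le]
    constructor <;> nlinarith [sq_nonneg k, sq_nonneg k', mul_nonneg k0 a3.1.le,
      mul_nonneg k0' a4.1.le]
  · have a3 := hE k r k0 hr
    have a4 := hE k' r k0' hr
    rw [abs_le]
    constructor <;> nlinarith [sq_nonneg k, sq_nonneg k', mul_nonneg (sq_nonneg k) a3.1.le,
      mul_nonneg (sq_nonneg k') a4.1.le]
  · filter_upwards [Lp.coeFn_sub (greenLp ν l' a) (greenLp ν l a), coeFn_greenLp hν hl a,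
      coeFn_greenLp hν hl' a] with x h1 h2 h3
    rw [h1, Pi.sub_apply, h2, h3, green, green, ← hk, ← hk']
    push_cast
    ring
  · filter_upwards [Lp.coeFn_sub (((l' * ν : ℝ) : ℂ) • greenLp ν l' a)
      (((l * ν : ℝ) : ℂ) • greenLp ν l a), Lp.coeFn_smul ((l' * ν : ℝ) : ℂ) (greenLp ν l' a),
      Lp.coeFn_smul ((l * ν : ℝ) : ℂ) (greenLp ν l a), coeFn_greenLp hν hl a,
      coeFn_greenLp hν hl' a] with x h1 h4 h5 h2 h3
    rw [h1, Pi.sub_apply, h4, h5, Pi.smul_apply, Pi.smul_apply, h2, h3, green, green, ← hk, ← hk',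
      e, e']
    simp only [smul_eq_mul]
    push_cast
    ring

/-- The `L²` function `G^l(· + y/2) + G^l(· - y/2)`. -/
def greenSumLp (ν l : ℝ) (y : R3) : L2 :=
  greenLp ν l (-((1 / 2 : ℝ) • y)) + greenLp ν l ((1 / 2 : ℝ) • y)

theorem coeFn_greenSumLp {ν l : ℝ} (hν : 0 < ν) (hl : 0 < l) (y : R3) :
    greenSumLp ν l y =ᵐ[volume] fun x : R3 => (greenSum ν l y x : ℂ) := by
  filter_upwards [Lp.coeFn_add (greenLp ν l (-((1 / 2 : ℝ) • y))) (greenLp ν l ((1 / 2 : ℝ) • y)),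
    coeFn_greenLp hν hl (-((1 / 2 : ℝ) • y)), coeFn_greenLp hν hl ((1 / 2 : ℝ) • y)] with x a b c
  rw [greenSumLp, a, Pi.add_apply, b, c, greenSum, sub_neg_eq_add]
  push_cast
  ring

theorem laplacian_greenSumLp_sub {ν l l' : ℝ} (hν : 0 < ν) (hl : 0 < l) (hl' : 0 < l') (y : R3) :
    Δ (toDist (greenSumLp ν l' y - greenSumLp ν l y)) =
      toDist (((l' * ν : ℝ) : ℂ) • greenSumLp ν l' y - ((l * ν : ℝ) : ℂ) • greenSumLp ν l y) := by
  have h1 := laplacian_greenLp_sub hν hl hl' (-((1 / 2 : ℝ) • y))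
  have h2 := laplacian_greenLp_sub hν hl hl' ((1 / 2 : ℝ) • y)
  have e1 : greenSumLp ν l' y - greenSumLp ν l y =
    (greenLp ν l' (-((1 / 2 : ℝ) • y)) - greenLp ν l (-((1 / 2 : ℝ) • y))) +
    (greenLp ν l' ((1 / 2 : ℝ) • y) - greenLp ν l ((1 / 2 : ℝ) • y)) := by
    simp only [greenSumLp]
    abel
  rw [e1, map_add, laplacian_add, h1, h2, ← map_add]
  congr 1
  simp only [greenSumLp, smul_add]
  abel

/-- The continuous extension of `G^{l'} - G^l`. -/
def greenDiff (ν l l' : ℝ) (x : R3) : ℝ :=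
  dslope (fun r : ℝ => Real.exp (-(Real.sqrt (l' * ν) * r)) - Real.exp (-(Real.sqrt (l * ν) * r)))
    0 ‖x‖

theorem hasDerivAt_exp_sub_exp_zero (k k' : ℝ) :
    HasDerivAt (fun r : ℝ => Real.exp (-(k' * r)) - Real.exp (-(k * r))) (k - k') 0 := by
  have h1 : ∀ k : ℝ, HasDerivAt (fun r : ℝ => Real.exp (-(k * r))) (-k) 0 := by
    intro k
    have := ((hasDerivAt_id (0 : ℝ)).const_mul k).neg.exp
    exact this.congr_deriv (by simp)
  exact ((h1 k').sub (h1 k)).congr_deriv (by ring)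

theorem continuous_greenDiff (ν l l' : ℝ) : Continuous (greenDiff ν l l') := by
  have h : Continuous (dslope (fun r : ℝ => Real.exp (-(Real.sqrt (l' * ν) * r)) -
      Real.exp (-(Real.sqrt (l * ν) * r))) 0) := by
    rw [← continuousOn_univ]
    refine (continuousOn_dslope univ_mem).mpr ⟨by fun_prop, ?_⟩
    exact (hasDerivAt_exp_sub_exp_zero _ _).differentiableAt
  exact h.comp continuous_norm

theorem greenDiff_zero (ν l l' : ℝ) :
    greenDiff ν l l' 0 = Real.sqrt (l * ν) - Real.sqrt (l' * ν) := by
  rw [greenDiff, norm_zero, dslope_same]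
  exact (hasDerivAt_exp_sub_exp_zero _ _).deriv

theorem greenDiff_of_ne (ν l l' : ℝ) {x : R3} (hx : x ≠ 0) :
    greenDiff ν l l' x = green ν l' x - green ν l x := by
  rw [greenDiff, dslope_of_ne _ (norm_ne_zero_iff.mpr hx), slope_def_field, green, green]
  simp
  ring

theorem green_neg (ν l : ℝ) (x : R3) : green ν l (-x) = green ν l x := by simp [green]

/-! ### Eigenvectors of the fast Hamiltonian -/

/-- The eigenvalue equation of the fast Hamiltonian below the essential spectrum. -/
theorem mem_fastGraph_iff {ν l l' : ℝ} (hν : 0 < ν) (hl : 0 < l) (hl' : 0 < l') (θ : ℝ → ℝ)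
    {y : R3} (hy : y ≠ 0) (u : L2) :
    (u, ((-l' : ℝ) : ℂ) • u) ∈ fastGraph ν θ y l ↔ ∃ q : ℂ, u = q • greenSumLp ν l' y ∧
      (q = 0 ∨ Real.exp (-(Real.sqrt (l' * ν) * ‖y‖)) - Real.sqrt (l' * ν) * ‖y‖ = θ ‖y‖) := by
  have hyn := norm_pos_iff.mpr hy
  have hνc : (ν : ℂ) ≠ 0 := by exact_mod_cast hν.ne'
  -- The continuous representative of the difference of Green's sums; its values at ±y/2 coincide,
  -- so one of the two boundary conditions implies the other.
  let D : R3 → ℝ := fun x => greenDiff ν l l' (x + (1 / 2 : ℝ) • y) +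
    greenDiff ν l l' (x - (1 / 2 : ℝ) • y)
  have hDc : Continuous D := by
    have := continuous_greenDiff ν l l'
    fun_prop
  have hy2 : (1 / 2 : ℝ) • y + (1 / 2 : ℝ) • y = y := by rw [← add_smul]; norm_num
  have hD1 : D ((1 / 2 : ℝ) • y) = green ν l' y - green ν l y +
      (Real.sqrt (l * ν) - Real.sqrt (l' * ν)) := by
    simp only [D]
    rw [hy2, sub_self, greenDiff_zero, greenDiff_of_ne _ _ _ hy]
  have hD2 : D (-((1 / 2 : ℝ) • y)) = green ν l' y - green ν l y +
      (Real.sqrt (l * ν) - Real.sqrt (l' * ν)) := by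
    simp only [D]
    rw [neg_add_cancel, ← neg_add', hy2, greenDiff_zero, greenDiff_of_ne _ _ _ (neg_ne_zero.mpr hy),
      green_neg, green_neg]
    ring
  have hDae : (greenSumLp ν l' y - greenSumLp ν l y : L2) =ᵐ[volume] fun x => (D x : ℂ) := by
    have h1 : ∀ᵐ x : R3, x ≠ (1 / 2 : ℝ) • y := by simp [ae_iff]
    have h2 : ∀ᵐ x : R3, x ≠ -((1 / 2 : ℝ) • y) := by simp [ae_iff]
    filter_upwards [Lp.coeFn_sub (greenSumLp ν l' y) (greenSumLp ν l y),
      coeFn_greenSumLp hν hl y, coeFn_greenSumLp hν hl' y, h1, h2] with x a b c d e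
    rw [a, Pi.sub_apply, b, c]
    simp only [D]
    rw [greenDiff_of_ne _ _ _ (sub_ne_zero.mpr d), greenDiff_of_ne, greenSum, greenSum]
    · push_cast
      ring
    · intro h
      exact e (eq_neg_of_add_eq_zero_left h)
  -- The terms in `l` cancel on the two sides. What is left, multiplied by |y|, is e^{-s} - s =
  -- θ(|y|) with s = √(l'ν)|y|.
  have hbc : ∀ q : ℂ, (q * (D ((1 / 2 : ℝ) • y) : ℂ) =
      q * ((θ ‖y‖ / ‖y‖ + Real.sqrt (l * ν) - green ν l y : ℝ) : ℂ) ↔ (q = 0 ∨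
      Real.exp (-(Real.sqrt (l' * ν) * ‖y‖)) - Real.sqrt (l' * ν) * ‖y‖ = θ ‖y‖)) := by
    intro q
    rw [hD1, mul_eq_mul_left_iff, or_comm, Complex.ofReal_inj, green]
    refine or_congr_right ?_
    constructor
    · intro h
      field_simp at h
      linarith
    · intro h
      rw [← h]
      field_simp
      ring
  have hL := laplacian_greenSumLp_sub hν hl hl' y
  constructor
  · rintro ⟨w, q, ⟨hw, hu, w', hw'c, hww', e1, e2⟩, h3⟩
    have hu' : u = w + q • greenSumLp ν l y := by
      apply Lp.ext
      filter_upwards [hu, Lp.coeFn_add w (q • greenSumLp ν l y), Lp.coeFn_smul q (greenSumLp ν l y),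
        coeFn_greenSumLp hν hl y] with x a b c d
      rw [a, b, Pi.add_apply, c, Pi.smul_apply, d, smul_eq_mul]
    have h4 : Δ (toDist w) = toDist (((ν : ℂ) * l) • w - ((ν : ℂ) * (l - l')) • u) := by
      simp only at h3
      have h5 : ((1 / ν : ℝ) : ℂ) • Δ (toDist w) = (l : ℂ) • toDist w -
          toDist (((-l' : ℝ) : ℂ) • u + (l : ℂ) • u) := by
        rw [h3]
        abel
      have h6 : Δ (toDist w) = (ν : ℂ) • (((1 / ν : ℝ) : ℂ) • Δ (toDist w)) := by
        rw [smul_smul]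
        push_cast
        rw [mul_one_div_cancel hνc, one_smul]
      rw [h6, h5, ← map_smul, ← map_sub, ← map_smul]
      congr 1
      push_cast
      module
    -- The remainder solves Δf = l'ν f in L², hence vanishes.
    have h0 : w - q • (greenSumLp ν l' y - greenSumLp ν l y) = 0 := by
      refine eq_zero_of_laplacian_eq_smul (c := l' * ν) (by positivity) ?_
      rw [sub_eq_add_neg, ← neg_smul, map_add, map_smul, laplacian_add, laplacian_smul, h4, hL,
        ← map_smul, ← map_add, ← map_smul, ← map_add, ← map_smul]
      congr 1
      rw [hu']
      push_cast
      module
    have hwe : w = q • (greenSumLp ν l' y - greenSumLp ν l y) := sub_eq_zero.mp h0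
    -- Continuous functions that agree almost everywhere agree at the points ±y/2 as well.
    have hwD : w' = fun x => q * (D x : ℂ) := by
      refine Measure.eq_of_ae_eq (μ := (volume : Measure R3)) ?_ hw'c (by fun_prop)
      filter_upwards [hww', hDae, Lp.coeFn_smul q (greenSumLp ν l' y - greenSumLp ν l y)] with
        x a b c
      rw [← a, hwe, c, Pi.smul_apply, b, smul_eq_mul]
    refine ⟨q, ?_, (hbc q).mp ?_⟩
    · rw [hu', hwe, ← smul_add, sub_add_cancel]
    · rw [← e1, hwD]
  · rintro ⟨q, rfl, hq⟩
    refine ⟨q • (greenSumLp ν l' y - greenSumLp ν l y), q, ⟨?_, ?_, fun x => q * (D x : ℂ),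
      by fun_prop, ?_, (hbc q).mpr hq, ?_⟩, ?_⟩
    · rw [MemH2, map_smul]
      exact (memH2_of_laplacian hL).smul q
    · filter_upwards [Lp.coeFn_smul q (greenSumLp ν l' y - greenSumLp ν l y),
        Lp.coeFn_smul q (greenSumLp ν l' y), Lp.coeFn_sub (greenSumLp ν l' y) (greenSumLp ν l y),
        coeFn_greenSumLp hν hl y] with x a b c d
      rw [a, b, Pi.smul_apply, Pi.smul_apply, c, Pi.sub_apply, d]
      simp only [smul_eq_mul]
      ring
    · filter_upwards [hDae, Lp.coeFn_smul q (greenSumLp ν l' y - greenSumLp ν l y)] with x b c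
      rw [c, Pi.smul_apply, b, smul_eq_mul]
    · change q * (D (-((1 / 2 : ℝ) • y)) : ℂ) = _
      rw [hD2, ← hD1]
      exact (hbc q).mpr hq
    · rw [map_smul toDist q (greenSumLp ν l' y - greenSumLp ν l y), laplacian_smul, hL,
        ← map_smul, ← map_smul, ← map_smul, ← map_smul, ← map_neg, ← map_add]
      congr 1
      have : ((1 / ν : ℝ) : ℂ) * ν = 1 := by
        push_cast
        exact one_div_mul_cancel hνc
      push_cast
      match_scalars <;> field_simp
      ring

theorem isEigenvector_iff_mem_graph (T : L2 →ₗ.[ℂ] L2) (z : ℂ) (u : L2) :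
    IsEigenvector T z u ↔ u ≠ 0 ∧ (u, z • u) ∈ T.graph := by
  rw [IsEigenvector, LinearPMap.mem_graph_iff]
  refine and_congr_right fun _ => ⟨fun ⟨hu, h⟩ => ⟨⟨u, hu⟩, rfl, h⟩, ?_⟩
  rintro ⟨⟨v, hv⟩, h1, h2⟩
  simp only at h1 h2
  subst h1
  exact ⟨hv, h2⟩

theorem smul_greenSumLp_ne_zero {ν l : ℝ} (hν : 0 < ν) (hl : 0 < l) (y : R3) {q : ℂ} (hq : q ≠ 0) :
    q • greenSumLp ν l y ≠ 0 := by
  refine smul_ne_zero hq fun h => ?_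
  refine one_ne_zero (charge_eq_zero ν l y 1 0 continuous_zero ?_)
  have := coeFn_greenSumLp hν hl y
  rw [h] at this
  filter_upwards [this, Lp.coeFn_zero ℂ 2 (volume : Measure R3)] with x a b
  rw [← a, b]
  simp

theorem isEigenvector_fastHamiltonian_iff {ν l l' : ℝ} (hν : 0 < ν) (hl : 0 < l) (hl' : 0 < l')
    (θ : ℝ → ℝ) {y : R3} (hy : y ≠ 0) (u : L2) :
    IsEigenvector (fastHamiltonian ν θ y l) ((-l' : ℝ) : ℂ) u ↔
      Real.sqrt (l' * ν) * ‖y‖ = lambertGap (θ ‖y‖) ∧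
      ∃ q : ℂ, q ≠ 0 ∧ u =ᵐ[volume] fun x => q * (greenSum ν l' y x : ℂ) := by
  have hae : ∀ q : ℂ, u = q • greenSumLp ν l' y ↔
      u =ᵐ[volume] fun x => q * (greenSum ν l' y x : ℂ) := by
    intro q
    have h : (q • greenSumLp ν l' y : L2) =ᵐ[volume] fun x => q * (greenSum ν l' y x : ℂ) := by
      filter_upwards [Lp.coeFn_smul q (greenSumLp ν l' y), coeFn_greenSumLp hν hl' y] with x a b
      rw [a, Pi.smul_apply, b, smul_eq_mul]
    exact ⟨fun hu => hu ▸ h, fun hu => Lp.ext (hu.trans h.symm)⟩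
  rw [isEigenvector_iff_mem_graph, graph_fastHamiltonian, mem_fastGraph_iff hν hl hl' θ hy,
    eq_comm (b := lambertGap _), lambertGap_eq_iff]
  constructor
  · rintro ⟨h0, q, hu, h⟩
    have hq : q ≠ 0 := by
      rintro rfl
      exact h0 (by rw [hu, zero_smul])
    exact ⟨h.resolve_left hq, q, hq, (hae q).mp hu⟩
  · rintro ⟨h, q, hq, hu⟩
    have hu' := (hae q).mpr hu
    exact ⟨hu' ▸ smul_greenSumLp_ne_zero hν hl' y hq, q, hu', Or.inr h⟩

/-- With s = W(e^θ) - θ, which is positive for θ < 1, the relation √(l'ν)|y| = s determines l'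
uniquely, and -l' is the effective potential. -/
theorem fastHamiltonian_spectrum {ν : ℝ} (hν : 0 < ν) (θ : ℝ → ℝ) {l : ℝ} {y : R3} (hl : 0 < l)
    (hy : y ≠ 0) (hθ : θ ‖y‖ < 1) :
    effPotential ν θ ‖y‖ < 0 ∧
      IsEigenvalue (fastHamiltonian ν θ y l) (effPotential ν θ ‖y‖ : ℂ) ∧
      (∀ e : ℝ, e < 0 → IsEigenvalue (fastHamiltonian ν θ y l) (e : ℂ) →
        e = effPotential ν θ ‖y‖) ∧
      (∀ u : L2, IsEigenvector (fastHamiltonian ν θ y l) (effPotential ν θ ‖y‖ : ℂ) u ↔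
          ∃ q : ℂ, q ≠ 0 ∧ u =ᵐ[volume] fun x =>
            q * (greenSum ν (-effPotential ν θ ‖y‖) y x : ℂ)) := by
  have hyn := norm_pos_iff.mpr hy
  have hs := lambertGap_pos hθ
  have hneg : effPotential ν θ ‖y‖ < 0 := by
    rw [effPotential_eq, neg_lt_zero]
    positivity
  have hsq : Real.sqrt (-effPotential ν θ ‖y‖ * ν) * ‖y‖ = lambertGap (θ ‖y‖) := by
    have : -effPotential ν θ ‖y‖ * ν = (lambertGap (θ ‖y‖) / ‖y‖) ^ 2 := by
      rw [effPotential_eq]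
      field_simp
    rw [this, Real.sqrt_sq (by positivity), div_mul_cancel₀ _ hyn.ne']
  have key : ∀ u : L2, IsEigenvector (fastHamiltonian ν θ y l) (effPotential ν θ ‖y‖ : ℂ) u ↔
          ∃ q : ℂ, q ≠ 0 ∧ u =ᵐ[volume] fun x =>
            q * (greenSum ν (-effPotential ν θ ‖y‖) y x : ℂ) := by
    intro u
    have := isEigenvector_fastHamiltonian_iff hν hl (neg_pos.mpr hneg) θ hy u
    rw [neg_neg] at this
    rw [this]
    exact and_iff_right hsq
  refine ⟨hneg, ⟨(1 : ℂ) • greenSumLp ν (-effPotential ν θ ‖y‖) y, (key _).mpr ⟨1, one_ne_zero, ?_⟩⟩,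
    fun e he ⟨u, hu⟩ => ?_, key⟩
  · simpa using coeFn_greenSumLp hν (neg_pos.mpr hneg) y
  · have h := (isEigenvector_fastHamiltonian_iff hν hl (neg_pos.mpr he) θ hy u).mp (by
      rwa [neg_neg])
    have h1 := h.1
    have h2 : -e * ν * ‖y‖ ^ 2 = lambertGap (θ ‖y‖) ^ 2 := by
      rw [← h1, mul_pow, Real.sq_sqrt (by nlinarith)]
    rw [effPotential_eq, ← h2]
    field_simp

/-! ### Linear ordinary differential equations with a parameter -/

theorem integral_exp_neg_mul_sub {c : ℝ} (hc : 0 < c) (t : ℝ) :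
    ∫ s in (0 : ℝ)..t, Real.exp (-(c * (t - s))) = (1 - Real.exp (-(c * t))) / c := by
  have h : ∀ s ∈ Set.uIcc 0 t, HasDerivAt (fun s => Real.exp (-(c * (t - s))) / c)
      (Real.exp (-(c * (t - s)))) s := by
    intro s _
    have := ((((hasDerivAt_id s).const_sub t).const_mul c).neg.exp).div_const c
    refine this.congr_deriv ?_
    simp only [Pi.neg_apply, id]
    field_simp
  rw [intervalIntegral.integral_eq_sub_of_hasDerivAt h
    ((by fun_prop : Continuous fun s => Real.exp (-(c * (t - s)))).intervalIntegrable _ _)]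
  simp
  ring

section LinearODE

variable {E : Type*} [NormedAddCommGroup E] [NormedSpace ℝ E]

/-- The damped integral operator whose fixed points solve a linear equation `x' = A x`. -/
def volterraFun (A : ℝ × ℝ → E →L[ℝ] E) (c : ℝ) (x₀ : E) (x : ℝ × ℝ → E) (z : ℝ × ℝ) : E :=
  Real.exp (-(c * max z.1 0)) • x₀ +
    ∫ s in (0 : ℝ)..max z.1 0, Real.exp (-(c * (max z.1 0 - s))) • A (s, z.2) (x (s, z.2))

theorem continuous_volterraFun {A : ℝ × ℝ → E →L[ℝ] E} (hA : Continuous A) (c : ℝ) (x₀ : E)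
    {x : ℝ × ℝ → E} (hx : Continuous x) : Continuous (volterraFun A c x₀ x) := by
  unfold volterraFun
  refine Continuous.add (by fun_prop) ?_
  refine intervalIntegral.continuous_parametric_intervalIntegral_of_continuous ?_ (by fun_prop)
  have h1 : Continuous fun p : (ℝ × ℝ) × ℝ => A (p.2, p.1.2) := hA.comp (by fun_prop)
  have h2 : Continuous fun p : (ℝ × ℝ) × ℝ => x (p.2, p.1.2) := hx.comp (by fun_prop)
  have h3 : Continuous fun p : (ℝ × ℝ) × ℝ => Real.exp (-(c * (max p.1.1 0 - p.2))) := by fun_prop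
  exact h3.smul (h1.clm_apply h2)

/-- The damping factor has integral at most 1/c whatever the length of the time interval, which
allows a global contraction argument. -/
theorem norm_integral_volterra_le {A : ℝ × ℝ → E →L[ℝ] E} {M c B : ℝ} (hM : ∀ z, ‖A z‖ ≤ M)
    (hc : 0 < c) {x : ℝ × ℝ → E} (hB : ∀ z, ‖x z‖ ≤ B) (z : ℝ × ℝ) :
    ‖∫ s in (0 : ℝ)..max z.1 0, Real.exp (-(c * (max z.1 0 - s))) • A (s, z.2) (x (s, z.2))‖ ≤
      M * B / c := by
  have hM0 : 0 ≤ M := (norm_nonneg _).trans (hM 0)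
  have hB0 : 0 ≤ B := (norm_nonneg _).trans (hB 0)
  have h0 : 0 ≤ max z.1 0 := le_max_right _ _
  calc _ ≤ ∫ s in (0 : ℝ)..max z.1 0, Real.exp (-(c * (max z.1 0 - s))) * (M * B) := by
        refine intervalIntegral.norm_integral_le_of_norm_le h0 (Eventually.of_forall fun s _ => ?_)
          ((by fun_prop : Continuous fun s =>
            Real.exp (-(c * (max z.1 0 - s))) * (M * B)).intervalIntegrable _ _)
        rw [norm_smul, Real.norm_of_nonneg (Real.exp_pos _).le]
        gcongr
        exact (A (s, z.2)).le_of_opNorm_le_of_le (hM _) (hB _)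
    _ = (1 - Real.exp (-(c * max z.1 0))) / c * (M * B) := by
        rw [intervalIntegral.integral_mul_const, integral_exp_neg_mul_sub hc]
    _ ≤ 1 / c * (M * B) := by
        gcongr
        linarith [Real.exp_pos (-(c * max z.1 0))]
    _ = _ := by ring

/-- The operator `volterraFun` on bounded continuous functions. -/
def volterraMap {A : ℝ × ℝ → E →L[ℝ] E} (hA : Continuous A) {M : ℝ} (hM : ∀ z, ‖A z‖ ≤ M) {c : ℝ}
    (hc : 0 < c) (x₀ : E) (x : BoundedContinuousFunction (ℝ × ℝ) E) :
    BoundedContinuousFunction (ℝ × ℝ) E :=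
  BoundedContinuousFunction.ofNormedAddCommGroup (volterraFun A c x₀ x)
    (continuous_volterraFun hA c x₀ x.continuous) (‖x₀‖ + M * ‖x‖ / c) fun z => by
      refine norm_add_le_of_le ?_ (norm_integral_volterra_le hM hc (fun z => x.norm_coe_le_norm z) z)
      rw [norm_smul, Real.norm_of_nonneg (Real.exp_pos _).le]
      refine mul_le_of_le_one_left (norm_nonneg _) (Real.exp_le_one_iff.mpr ?_)
      have : 0 ≤ max z.1 0 := le_max_right _ _
      have := mul_nonneg hc.le this
      linarith

/-- The unknown is e^{-ct} times the solution, obtained as a fixed point among bounded continuous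
functions of time and parameter jointly. Continuous dependence on the parameter is thereby part of
the construction. Negative times are clamped to 0. -/
theorem exists_linear_ode_solution [CompleteSpace E] {A : ℝ × ℝ → E →L[ℝ] E} (hA : Continuous A)
    {M : ℝ} (hM : ∀ z, ‖A z‖ ≤ M) (x₀ : E) :
    ∃ x : ℝ × ℝ → E, Continuous x ∧ (∀ l, x (0, l) = x₀) ∧
      ∀ l t, 0 < t → HasDerivAt (fun t => x (t, l)) (A (t, l) (x (t, l))) t := by
  have hM0 : 0 ≤ M := (norm_nonneg _).trans (hM 0)
  -- This gives M/c ≤ 1/2, and the summand 1 keeps `c` positive when M = 0.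
  let c : ℝ := 2 * M + 1
  have hc : 0 < c := by positivity
  have hcon : ContractingWith (1 / 2) (volterraMap hA hM hc x₀) := by
    refine ⟨by
      rw [← NNReal.coe_lt_coe]
      norm_num, LipschitzWith.of_dist_le_mul fun x y => ?_⟩
    rw [dist_eq_norm, dist_eq_norm]
    refine (BoundedContinuousFunction.norm_le (by positivity)).mpr fun z => ?_
    have hI : ∀ x : BoundedContinuousFunction (ℝ × ℝ) E, IntervalIntegrable
        (fun s => Real.exp (-(c * (max z.1 0 - s))) • A (s, z.2) (x (s, z.2))) volume 0
          (max z.1 0) := by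
      intro x
      have h1 : Continuous fun s : ℝ => A (s, z.2) := hA.comp (by fun_prop)
      have h2 : Continuous fun s : ℝ => x (s, z.2) := x.continuous.comp (by fun_prop)
      have h3 : Continuous fun s : ℝ => Real.exp (-(c * (max z.1 0 - s))) := by fun_prop
      exact (h3.smul (h1.clm_apply h2)).intervalIntegrable _ _
    have h := norm_integral_volterra_le hM hc (fun z => (x - y).norm_coe_le_norm z) z
    have e : (volterraMap hA hM hc x₀ x - volterraMap hA hM hc x₀ y) z =
        ∫ s in (0 : ℝ)..max z.1 0, Real.exp (-(c * (max z.1 0 - s))) •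
          A (s, z.2) ((x - y) (s, z.2)) := by
      change volterraFun A c x₀ x z - volterraFun A c x₀ y z = _
      rw [volterraFun, volterraFun, add_sub_add_left_eq_sub,
        ← intervalIntegral.integral_sub (hI x) (hI y)]
      simp [smul_sub]
    rw [e]
    refine h.trans ?_
    rw [div_le_iff₀ hc]
    simp only [c]
    push_cast
    nlinarith [norm_nonneg (x - y)]
  obtain ⟨x, hx⟩ : ∃ x, volterraMap hA hM hc x₀ x = x := ⟨_, hcon.fixedPoint_isFixedPt⟩
  have hxz : ∀ z, volterraFun A c x₀ x z = x z := fun z => congrArg (fun f => f z) hx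
  have hint : ∀ l t, 0 ≤ t → Real.exp (c * t) • x (t, l) =
      x₀ + ∫ s in (0 : ℝ)..t, A (s, l) (Real.exp (c * s) • x (s, l)) := by
    intro l t ht
    rw [← hxz, volterraFun, smul_add, smul_smul, ← Real.exp_add]
    simp only [max_eq_left ht]
    rw [add_neg_cancel, Real.exp_zero, one_smul, ← intervalIntegral.integral_smul]
    congr 1
    refine intervalIntegral.integral_congr fun s _ => ?_
    rw [smul_smul, ← Real.exp_add, map_smul]
    congr 2
    ring
  have hcont : Continuous fun z : ℝ × ℝ => Real.exp (c * z.1) • x z :=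
    (by fun_prop : Continuous fun z : ℝ × ℝ => Real.exp (c * z.1)).smul x.continuous
  refine ⟨fun z => Real.exp (c * z.1) • x z, hcont, fun l => ?_, fun l t ht => ?_⟩
  · simpa using hint l 0 le_rfl
  · have hg : Continuous fun s : ℝ => A (s, l) (Real.exp (c * s) • x (s, l)) :=
      (hA.comp (by fun_prop : Continuous fun s : ℝ => (s, l))).clm_apply
        (hcont.comp (by fun_prop : Continuous fun s : ℝ => (s, l)))
    have h := (intervalIntegral.integral_hasDerivAt_right (hg.intervalIntegrable 0 t)
      (hg.stronglyMeasurableAtFilter _ _) hg.continuousAt).const_add x₀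
    refine h.congr_of_eventuallyEq ?_
    filter_upwards [Ioi_mem_nhds ht] with s hs
    exact hint l s (Set.mem_Ioi.mp hs).le

end LinearODE

theorem exists_second_order_solution {p : ℝ × ℝ → ℝ} (hp : Continuous p) {K : ℝ}
    (hK : ∀ z, |p z| ≤ K) :
    ∃ χ χ₁ : ℝ × ℝ → ℝ, Continuous χ ∧ Continuous χ₁ ∧ (∀ l, χ (0, l) = 0) ∧
      (∀ l, χ₁ (0, l) = 1) ∧ ∀ l t, 0 < t → HasDerivAt (fun t => χ (t, l)) (χ₁ (t, l)) t ∧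
      HasDerivAt (fun t => χ₁ (t, l)) (p (t, l) * χ (t, l)) t := by
  let B₀ : ℝ × ℝ →L[ℝ] ℝ × ℝ := (ContinuousLinearMap.snd ℝ ℝ ℝ).prod 0
  let B₁ : ℝ × ℝ →L[ℝ] ℝ × ℝ := ContinuousLinearMap.prod 0 (ContinuousLinearMap.fst ℝ ℝ ℝ)
  obtain ⟨x, hx, h0, hd⟩ := exists_linear_ode_solution (A := fun z => B₀ + p z • B₁)
    (by fun_prop) (M := ‖B₀‖ + K * ‖B₁‖) (fun z => by
      refine norm_add_le_of_le le_rfl ?_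
      rw [norm_smul]
      gcongr
      exact hK z) (0, 1)
  refine ⟨fun z => (x z).1, fun z => (x z).2, by fun_prop, by fun_prop, fun l => by simp [h0],
    fun l => by simp [h0], fun l t ht => ?_⟩
  have h := hd l t ht
  have h1 := (ContinuousLinearMap.fst ℝ ℝ ℝ).hasFDerivAt.comp_hasDerivAt t h
  have h2 := (ContinuousLinearMap.snd ℝ ℝ ℝ).hasFDerivAt.comp_hasDerivAt t h
  exact ⟨h1.congr_deriv (by simp [B₀, B₁]), h2.congr_deriv (by simp [B₀, B₁])⟩

/-- A differential inequality `|N'| ≤ e' N` bounds the growth and the decay of `N`. -/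
theorem le_mul_exp_of_abs_deriv_le {N N' e e' : ℝ → ℝ} {s t : ℝ} (hst : s ≤ t)
    (hNc : ContinuousOn N (Set.Icc s t)) (hec : ContinuousOn e (Set.Icc s t))
    (hN : ∀ x ∈ Set.Ioo s t, HasDerivAt N (N' x) x) (he : ∀ x ∈ Set.Ioo s t, HasDerivAt e (e' x) x)
    (h : ∀ x ∈ Set.Ioo s t, |N' x| ≤ e' x * N x) :
    N t ≤ N s * Real.exp (e t - e s) ∧ N s ≤ N t * Real.exp (e t - e s) := by
  have h1 : AntitoneOn (fun x => N x * Real.exp (-e x)) (Set.Icc s t) := by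
    refine antitoneOn_of_deriv_nonpos (convex_Icc s t) (by fun_prop) ?_ ?_
    · rw [interior_Icc]
      exact fun x hx => ((hN x hx).mul (he x hx).neg.exp).differentiableAt.differentiableWithinAt
    · rw [interior_Icc]
      intro x hx
      have hd : HasDerivAt (fun x => N x * Real.exp (-e x)) _ x := (hN x hx).mul (he x hx).neg.exp
      rw [hd.deriv]
      simp only [Pi.neg_apply]
      have := (le_abs_self _).trans (h x hx)
      nlinarith [Real.exp_pos (-e x)]
  have h2 : MonotoneOn (fun x => N x * Real.exp (e x)) (Set.Icc s t) := by
    refine monotoneOn_of_deriv_nonneg (convex_Icc s t) (by fun_prop) ?_ ?_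
    · rw [interior_Icc]
      exact fun x hx => ((hN x hx).mul (he x hx).exp).differentiableAt.differentiableWithinAt
    · rw [interior_Icc]
      intro x hx
      have hd : HasDerivAt (fun x => N x * Real.exp (e x)) _ x := (hN x hx).mul (he x hx).exp
      rw [hd.deriv]
      have := (neg_abs_le _).trans' (neg_le_neg (h x hx))
      nlinarith [Real.exp_pos (e x)]
  have a := h1 (Set.left_mem_Icc.mpr hst) (Set.right_mem_Icc.mpr hst) hst
  have b := h2 (Set.left_mem_Icc.mpr hst) (Set.right_mem_Icc.mpr hst) hst
  simp only at a b
  constructor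
  · calc N t = N t * Real.exp (-e t) * Real.exp (e t) := by
          rw [mul_assoc, ← Real.exp_add]
          simp
      _ ≤ N s * Real.exp (-e s) * Real.exp (e t) := by gcongr
      _ = _ := by
          rw [mul_assoc, ← Real.exp_add]
          ring_nf
  · calc N s = N s * Real.exp (e s) * Real.exp (-e s) := by
          rw [mul_assoc, ← Real.exp_add]
          simp
      _ ≤ N t * Real.exp (e t) * Real.exp (-e s) := by gcongr
      _ = _ := by
          rw [mul_assoc, ← Real.exp_add]
          ring_nf

/-- Solutions of `f'' = p f` with `p` bounded depend on their data with at most exponential loss. -/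
theorem second_order_bound {f f₁ p : ℝ → ℝ} {K s t : ℝ} (hst : s ≤ t)
    (hf : ContinuousOn f (Set.Icc s t)) (hf₁ : ContinuousOn f₁ (Set.Icc s t))
    (h : ∀ x ∈ Set.Ioo s t, HasDerivAt f (f₁ x) x)
    (h₁ : ∀ x ∈ Set.Ioo s t, HasDerivAt f₁ (p x * f x) x) (hK : ∀ x ∈ Set.Ioo s t, |p x| ≤ K) :
    f t ^ 2 + f₁ t ^ 2 ≤ (f s ^ 2 + f₁ s ^ 2) * Real.exp ((1 + K) * (t - s)) ∧
    f s ^ 2 + f₁ s ^ 2 ≤ (f t ^ 2 + f₁ t ^ 2) * Real.exp ((1 + K) * (t - s)) := by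
  have key := le_mul_exp_of_abs_deriv_le (N := fun x => f x ^ 2 + f₁ x ^ 2)
    (N' := fun x => 2 * (f x * f₁ x) * (1 + p x)) (e := fun x => (1 + K) * x)
    (e' := fun _ => 1 + K) hst (by fun_prop) (by fun_prop)
    (fun x hx => (((h x hx).pow 2).add ((h₁ x hx).pow 2)).congr_deriv (by
      push_cast
      ring))
    (fun x _ => by simpa using (hasDerivAt_id x).const_mul (1 + K)) (fun x hx => by
      have hk := hK x hx
      have a1 : |2 * (f x * f₁ x)| ≤ f x ^ 2 + f₁ x ^ 2 := by
        rw [abs_le]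
        constructor <;> nlinarith [sq_nonneg (f x + f₁ x), sq_nonneg (f x - f₁ x)]
      have a2 : |1 + p x| ≤ 1 + K := (abs_add_le _ _).trans (by simpa using hk)
      rw [abs_mul, mul_comm]
      gcongr
      linarith [abs_nonneg (p x)])
  simpa [mul_sub] using key

/-! ### The decaying solution of the exterior equation -/

/-- This is cosh s = 1 + 2 sinh²(s/2) combined with |sinh x| ≥ |x|. -/
theorem sq_div_two_le_cosh (s : ℝ) : 1 + s ^ 2 / 2 ≤ Real.cosh s := by
  have h1 : s / 2 * (s / 2) ≤ Real.sinh (s / 2) * Real.sinh (s / 2) := by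
    rcases le_total 0 s with h | h
    · have := Real.self_le_sinh_iff.mpr (by linarith : 0 ≤ s / 2)
      exact mul_self_le_mul_self (by linarith) this
    · have := Real.sinh_le_self_iff.mpr (by linarith : s / 2 ≤ 0)
      nlinarith
  have h2 := Real.cosh_sq (s / 2)
  have h3 : Real.cosh s = Real.cosh (s / 2) ^ 2 + Real.sinh (s / 2) ^ 2 := by
    rw [← Real.cosh_two_mul]
    congr 1
    ring
  nlinarith

theorem abs_sinh_le_cosh (s : ℝ) : |Real.sinh s| ≤ Real.cosh s := by
  refine abs_le_of_sq_le_sq ?_ (Real.cosh_pos s).le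
  have := Real.cosh_sq s
  linarith

/-- Half of the exponent absorbs the power of cosh; the other half gives a Gaussian, because cosh s
≥ s²/2. -/
theorem integrable_mul_exp_neg_cosh {t : ℝ} (ht : 0 < t) {f : ℝ → ℝ} (hf : Continuous f) {C : ℝ}
    {n : ℕ} (hb : ∀ s, |f s| ≤ C * Real.cosh s ^ n) :
    Integrable fun s => f s * Real.exp (-(t * Real.cosh s)) := by
  have hC : 0 ≤ C := by
    have := (abs_nonneg _).trans (hb 0)
    simpa using this
  have h1 : Integrable fun s : ℝ => (C * (n.factorial * (2 / t) ^ n)) * Real.exp (-(t / 4) * s ^ 2) :=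
    (integrable_exp_neg_mul_sq (by positivity)).const_mul _
  refine h1.mono' (by fun_prop) (Eventually.of_forall fun s => ?_)
  have hc := Real.cosh_pos s
  have h2 : Real.cosh s ^ n ≤ n.factorial * (2 / t) ^ n * Real.exp (t / 2 * Real.cosh s) := by
    have h := Real.pow_div_factorial_le_exp (x := t / 2 * Real.cosh s) (by positivity) n
    rw [div_le_iff₀ (by positivity), mul_pow] at h
    calc Real.cosh s ^ n = (2 / t) ^ n * ((t / 2) ^ n * Real.cosh s ^ n) := by
          rw [← mul_assoc, ← mul_pow]
          field_simp
          simp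
      _ ≤ (2 / t) ^ n * (Real.exp (t / 2 * Real.cosh s) * n.factorial) := by gcongr
      _ = _ := by ring
  have h3 : Real.exp (t / 2 * Real.cosh s) * Real.exp (-(t * Real.cosh s)) ≤
      Real.exp (-(t / 4) * s ^ 2) := by
    rw [← Real.exp_add]
    apply Real.exp_le_exp.mpr
    have := sq_div_two_le_cosh s
    nlinarith
  rw [norm_mul, Real.norm_eq_abs, Real.norm_of_nonneg (Real.exp_pos _).le]
  calc |f s| * Real.exp (-(t * Real.cosh s))
      ≤ C * (n.factorial * (2 / t) ^ n * Real.exp (t / 2 * Real.cosh s)) *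
        Real.exp (-(t * Real.cosh s)) := by
        gcongr
        exact (hb s).trans (by gcongr)
    _ = C * (n.factorial * (2 / t) ^ n) *
        (Real.exp (t / 2 * Real.cosh s) * Real.exp (-(t * Real.cosh s))) := by ring
    _ ≤ _ := by gcongr

/-- The moments `∫ cosh(s)ⁿ exp(-t cosh s) cos(β s) ds`; up to a factor, the Macdonald function
`K_{iβ}(t)` and its derivatives. -/
def macdonald (β : ℝ) (n : ℕ) (t : ℝ) : ℝ :=
  ∫ s, Real.cosh s ^ n * Real.cos (β * s) * Real.exp (-(t * Real.cosh s))

theorem abs_cosh_pow_mul_cos_le (β : ℝ) (n : ℕ) (s : ℝ) :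
    |Real.cosh s ^ n * Real.cos (β * s)| ≤ Real.cosh s ^ n := by
  have := Real.cosh_pos s
  rw [abs_mul, abs_of_pos (by positivity)]
  exact mul_le_of_le_one_right (by positivity) (Real.abs_cos_le_one _)

theorem integrable_macdonald (β : ℝ) (n : ℕ) {t : ℝ} (ht : 0 < t) :
    Integrable fun s => Real.cosh s ^ n * Real.cos (β * s) * Real.exp (-(t * Real.cosh s)) :=
  integrable_mul_exp_neg_cosh ht (by fun_prop) (C := 1) (n := n)
    (fun s => by simpa using abs_cosh_pow_mul_cos_le β n s)

theorem hasDerivAt_macdonald (β : ℝ) (n : ℕ) {t : ℝ} (ht : 0 < t) :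
    HasDerivAt (macdonald β n) (-macdonald β (n + 1) t) t := by
  have h := (hasDerivAt_integral_of_dominated_loc_of_deriv_le (μ := volume) (x₀ := t)
    (F := fun t s => Real.cosh s ^ n * Real.cos (β * s) * Real.exp (-(t * Real.cosh s)))
    (F' := fun t s => -(Real.cosh s ^ (n + 1) * Real.cos (β * s) * Real.exp (-(t * Real.cosh s))))
    (s := Set.Ioi (t / 2))
    (bound := fun s => Real.cosh s ^ (n + 1) * Real.exp (-(t / 2 * Real.cosh s)))
    (Ioi_mem_nhds (by linarith)) (Eventually.of_forall fun t => by fun_prop)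
    (integrable_macdonald β n ht) (by fun_prop) (Eventually.of_forall fun s x hx => ?_)
    (integrable_mul_exp_neg_cosh (by positivity) (by fun_prop) (C := 1) (n := n + 1) fun s => by
      have := Real.cosh_pos s
      rw [abs_of_pos (by positivity), one_mul])
    (Eventually.of_forall fun s x hx => ?_)).2
  · rw [integral_neg] at h
    exact h
  · have hc := Real.cosh_pos s
    rw [norm_neg, norm_mul, Real.norm_eq_abs, Real.norm_of_nonneg (Real.exp_pos _).le]
    gcongr
    · exact abs_cosh_pow_mul_cos_le β (n + 1) s
    · exact (Set.mem_Ioi.mp hx).le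
  · have := (((hasDerivAt_id x).mul_const (Real.cosh s)).neg.exp).const_mul
      (Real.cosh s ^ n * Real.cos (β * s))
    refine this.congr_deriv ?_
    simp only [Pi.neg_apply, id]
    ring

theorem hasDerivAt_exp_neg_cosh (t s : ℝ) : HasDerivAt (fun s => Real.exp (-(t * Real.cosh s)))
    (-(t * Real.sinh s) * Real.exp (-(t * Real.cosh s))) s := by
  have := ((Real.hasDerivAt_cosh s).const_mul t).neg.exp
  refine this.congr_deriv ?_
  simp only [Pi.neg_apply]
  ring

/-- The modified Bessel equation. -/
theorem macdonald_equation (β : ℝ) {t : ℝ} (ht : 0 < t) :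
    t ^ 2 * macdonald β 2 t - t * macdonald β 1 t = (t ^ 2 - β ^ 2) * macdonald β 0 t := by
  have I0 := integrable_macdonald β 0 ht
  have I1 := integrable_macdonald β 1 ht
  have I2 := integrable_macdonald β 2 ht
  have hu' : ∀ s, HasDerivAt (fun s => -(t * Real.sinh s) * Real.exp (-(t * Real.cosh s)))
      ((t ^ 2 * Real.cosh s ^ 2 - t ^ 2 - t * Real.cosh s) * Real.exp (-(t * Real.cosh s))) s := by
    intro s
    refine ((((Real.hasDerivAt_sinh s).const_mul t).neg).mul
      (hasDerivAt_exp_neg_cosh t s)).congr_deriv ?_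
    simp only [Pi.neg_apply]
    rw [Real.cosh_sq s]
    ring
  have hv : ∀ s, HasDerivAt (fun s => Real.cos (β * s)) (-(β * Real.sin (β * s))) s := by
    intro s
    exact (((hasDerivAt_id s).const_mul β).cos).congr_deriv (by simp; ring)
  have hv' : ∀ s, HasDerivAt (fun s => -(β * Real.sin (β * s)))
      (-(β ^ 2 * Real.cos (β * s))) s := by
    intro s
    exact ((((hasDerivAt_id s).const_mul β).sin).const_mul β).neg.congr_deriv (by simp; ring)
  have J0 : Integrable fun s => Real.exp (-(t * Real.cosh s)) * -(β ^ 2 * Real.cos (β * s)) := by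
    refine (I0.const_mul (-β ^ 2)).congr (Eventually.of_forall fun s => ?_)
    simp
    ring
  have hsin : ∀ s : ℝ, |Real.sin (β * s)| ≤ 1 := fun s => Real.abs_sin_le_one _
  have hcos : ∀ s : ℝ, |Real.cos (β * s)| ≤ 1 := fun s => Real.abs_cos_le_one _
  have J1 : Integrable fun s => (-(t * Real.sinh s) * Real.exp (-(t * Real.cosh s))) *
      -(β * Real.sin (β * s)) := by
    refine (integrable_mul_exp_neg_cosh ht (f := fun s => t * Real.sinh s * (β * Real.sin (β * s)))
      (by fun_prop) (C := t * |β|) (n := 1) (fun s => ?_)).congr (Eventually.of_forall fun s => ?_)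
    · rw [abs_mul, abs_mul, abs_mul, abs_of_pos ht, pow_one]
      calc t * |Real.sinh s| * (|β| * |Real.sin (β * s)|) ≤ t * Real.cosh s * (|β| * 1) := by
            gcongr
            · exact abs_sinh_le_cosh s
            · exact hsin s
        _ = _ := by ring
    · simp only
      ring
  have J2 : Integrable fun s => Real.exp (-(t * Real.cosh s)) * -(β * Real.sin (β * s)) := by
    refine (integrable_mul_exp_neg_cosh ht (f := fun s => -(β * Real.sin (β * s)))
      (by fun_prop) (C := |β|) (n := 0) (fun s => ?_)).congr (Eventually.of_forall fun s => ?_)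
    · rw [abs_neg, abs_mul, pow_zero]
      gcongr
      exact hsin s
    · simp only
      ring
  have J3 : Integrable fun s => (-(t * Real.sinh s) * Real.exp (-(t * Real.cosh s))) *
      Real.cos (β * s) := by
    refine (integrable_mul_exp_neg_cosh ht (f := fun s => -(t * Real.sinh s * Real.cos (β * s)))
      (by fun_prop) (C := t) (n := 1) (fun s => ?_)).congr (Eventually.of_forall fun s => ?_)
    · rw [abs_neg, abs_mul, abs_mul, abs_of_pos ht, pow_one]
      calc t * |Real.sinh s| * |Real.cos (β * s)| ≤ t * Real.cosh s * 1 := by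
            gcongr
            · exact abs_sinh_le_cosh s
            · exact hcos s
        _ = _ := by ring
    · simp only
      ring
  have J4 : Integrable fun s => ((t ^ 2 * Real.cosh s ^ 2 - t ^ 2 - t * Real.cosh s) *
      Real.exp (-(t * Real.cosh s))) * Real.cos (β * s) := by
    refine (((I2.const_mul (t ^ 2)).sub (I0.const_mul (t ^ 2))).sub (I1.const_mul t)).congr
      (Eventually.of_forall fun s => ?_)
    simp
    ring
  -- Two integrations by parts move both derivatives from cos(βs), where they produce -β², to e^{-t
  -- cosh s}, where they produce t² cosh² s - t² - t cosh s.
  have e1 := integral_mul_deriv_eq_deriv_mul_of_integrable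
    (fun s _ => hasDerivAt_exp_neg_cosh t s) (fun s _ => hv' s) J0 J1 J2
  have e2 := integral_mul_deriv_eq_deriv_mul_of_integrable
    (fun s _ => hu' s) (fun s _ => hv s) J1 J4 J3
  have e3 : ∫ s, Real.exp (-(t * Real.cosh s)) * -(β ^ 2 * Real.cos (β * s)) =
      -β ^ 2 * macdonald β 0 t := by
    rw [macdonald, ← integral_const_mul]
    congr 1
    ext s
    simp
    ring
  have e4 : ∫ s, ((t ^ 2 * Real.cosh s ^ 2 - t ^ 2 - t * Real.cosh s) *
      Real.exp (-(t * Real.cosh s))) * Real.cos (β * s) =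
      t ^ 2 * macdonald β 2 t - t ^ 2 * macdonald β 0 t - t * macdonald β 1 t := by
    have I3 : Integrable fun s =>
        t ^ 2 * (Real.cosh s ^ 2 * Real.cos (β * s) * Real.exp (-(t * Real.cosh s))) -
        t ^ 2 * (Real.cosh s ^ 0 * Real.cos (β * s) * Real.exp (-(t * Real.cosh s))) :=
      (I2.const_mul (t ^ 2)).sub (I0.const_mul (t ^ 2))
    rw [macdonald, macdonald, macdonald, ← integral_const_mul, ← integral_const_mul,
      ← integral_const_mul, ← integral_sub (I2.const_mul _) (I0.const_mul _),
      ← integral_sub I3 (I1.const_mul _)]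
    congr 1
    ext s
    simp
    ring
  rw [e3, e2, e4] at e1
  linarith

/-- By cos x ≥ 1 - x²/2 the integral is at least ∫ e^{-t cosh s} - (β²/2) ∫ s² e^{-t cosh s}.
Moreover s² ≤ s sinh s, and an integration by parts gives ∫ s sinh s e^{-t cosh s} = t⁻¹ ∫ e^{-t
cosh s}. It serves to show that the decaying solution is not identically zero. -/
theorem macdonald_pos (β : ℝ) {t : ℝ} (ht : 0 < t) (hβ : β ^ 2 / 2 < t) : 0 < macdonald β 0 t := by
  have I0 : Integrable fun s => Real.exp (-(t * Real.cosh s)) := by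
    simpa using integrable_mul_exp_neg_cosh ht (f := fun _ => 1) (by fun_prop) (C := 1) (n := 0)
      (fun s => by simp)
  have hs : ∀ s : ℝ, |s| ≤ Real.cosh s := fun s => by
    have := sq_div_two_le_cosh s
    rw [abs_le]
    constructor <;> nlinarith [sq_nonneg (s - 1), sq_nonneg (s + 1)]
  have I1 : Integrable fun s => s * Real.exp (-(t * Real.cosh s)) :=
    integrable_mul_exp_neg_cosh ht (by fun_prop) (C := 1) (n := 1) (fun s => by simpa using hs s)
  have I2 : Integrable fun s => s * Real.sinh s * Real.exp (-(t * Real.cosh s)) := by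
    refine integrable_mul_exp_neg_cosh ht (by fun_prop) (C := 1) (n := 2) (fun s => ?_)
    rw [abs_mul, one_mul, sq]
    exact mul_le_mul (hs s) (abs_sinh_le_cosh s) (abs_nonneg _) (Real.cosh_pos s).le
  have I3 : Integrable fun s => s ^ 2 * Real.exp (-(t * Real.cosh s)) := by
    refine integrable_mul_exp_neg_cosh ht (by fun_prop) (C := 1) (n := 2) (fun s => ?_)
    rw [abs_pow, one_mul]
    exact pow_le_pow_left₀ (abs_nonneg _) (hs s) 2
  have e1 : ∫ s, s * (-(t * Real.sinh s) * Real.exp (-(t * Real.cosh s))) =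
      -∫ s, 1 * Real.exp (-(t * Real.cosh s)) := by
    refine integral_mul_deriv_eq_deriv_mul_of_integrable (fun s _ => hasDerivAt_id s)
      (fun s _ => hasDerivAt_exp_neg_cosh t s) ?_
      (I0.congr (Eventually.of_forall fun s => by simp)) I1
    refine (I2.const_mul (-t)).congr (Eventually.of_forall fun s => ?_)
    simp
    ring
  have e2 : ∫ s, s * Real.sinh s * Real.exp (-(t * Real.cosh s)) =
      t⁻¹ * ∫ s, Real.exp (-(t * Real.cosh s)) := by
    have : ∫ s, s * (-(t * Real.sinh s) * Real.exp (-(t * Real.cosh s))) =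
        -t * ∫ s, s * Real.sinh s * Real.exp (-(t * Real.cosh s)) := by
      rw [← integral_const_mul]
      congr 1
      ext s
      ring
    rw [this] at e1
    simp only [one_mul] at e1
    field_simp
    linarith
  have e3 : ∫ s, s ^ 2 * Real.exp (-(t * Real.cosh s)) ≤
      ∫ s, s * Real.sinh s * Real.exp (-(t * Real.cosh s)) := by
    refine integral_mono I3 I2 fun s => ?_
    have : s ^ 2 ≤ s * Real.sinh s := by
      rcases le_total 0 s with h | h
      · have := Real.self_le_sinh_iff.mpr h
        nlinarith
      · have := Real.sinh_le_self_iff.mpr h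
        nlinarith
    simp only
    gcongr
  have e4 : 0 < ∫ s, Real.exp (-(t * Real.cosh s)) := integral_exp_pos I0
  have e5 : (∫ s, Real.exp (-(t * Real.cosh s))) - β ^ 2 / 2 *
      ∫ s, s ^ 2 * Real.exp (-(t * Real.cosh s)) ≤ macdonald β 0 t := by
    rw [macdonald, ← integral_const_mul, ← integral_sub I0 (I3.const_mul _)]
    refine integral_mono (I0.sub (I3.const_mul _)) (integrable_macdonald β 0 ht) fun s => ?_
    have := Real.one_sub_sq_div_two_le_cos (x := β * s)
    simp only [pow_zero, one_mul]
    nlinarith [Real.exp_pos (-(t * Real.cosh s))]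
  have e6 : β ^ 2 / 2 * t⁻¹ < 1 := by
    rw [← div_eq_mul_inv, div_lt_one ht]
    exact hβ
  have e7 : β ^ 2 / 2 * ∫ s, s ^ 2 * Real.exp (-(t * Real.cosh s)) ≤
      β ^ 2 / 2 * (t⁻¹ * ∫ s, Real.exp (-(t * Real.cosh s))) := by
    rw [← e2]
    gcongr
  nlinarith

/-- For t ≥ 1 one has t cosh s ≥ cosh s + (t - 1), since cosh s ≥ 1. -/
theorem abs_macdonald_le (β : ℝ) (n : ℕ) {t : ℝ} (ht : 1 ≤ t) :
    |macdonald β n t| ≤ macdonald 0 n 1 * Real.exp (1 - t) := by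
  rw [macdonald, macdonald, ← integral_mul_const, ← Real.norm_eq_abs]
  refine norm_integral_le_of_norm_le ((integrable_macdonald 0 n one_pos).mul_const _)
    (Eventually.of_forall fun s => ?_)
  have hc := Real.one_le_cosh s
  rw [norm_mul, Real.norm_eq_abs, Real.norm_of_nonneg (Real.exp_pos _).le, mul_assoc _ (Real.exp _),
    ← Real.exp_add]
  simp only [zero_mul, Real.cos_zero, mul_one]
  gcongr
  · exact abs_cosh_pow_mul_cos_le β n s
  · nlinarith

/-- A nontrivial solution of `g'' = (exp(2x) - β²) g` that decays at infinity. -/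
theorem exists_decaying_solution (β : ℝ) : ∃ g g₁ : ℝ → ℝ, (∀ x, HasDerivAt g (g₁ x) x) ∧
    (∀ x, HasDerivAt g₁ ((Real.exp (2 * x) - β ^ 2) * g x) x) ∧
    (∃ C, ∀ x, 0 ≤ x → |g x| ≤ C * Real.exp (-Real.exp x) ∧
      |g₁ x| ≤ C * Real.exp x * Real.exp (-Real.exp x)) ∧ ∃ x, g x ≠ 0 := by
  -- The substitution t = e^x turns the modified Bessel equation into the stated one.
  refine ⟨fun x => macdonald β 0 (Real.exp x), fun x => -(Real.exp x * macdonald β 1 (Real.exp x)),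
    fun x => ?_, fun x => ?_, ⟨(macdonald 0 0 1 + macdonald 0 1 1) * Real.exp 1, fun x hx => ?_⟩, ?_⟩
  · have := (hasDerivAt_macdonald β 0 (Real.exp_pos x)).comp x (Real.hasDerivAt_exp x)
    exact this.congr_deriv (by ring)
  · have := ((Real.hasDerivAt_exp x).mul ((hasDerivAt_macdonald β 1 (Real.exp_pos x)).comp x
      (Real.hasDerivAt_exp x))).neg
    refine this.congr_deriv ?_
    have h := macdonald_equation β (Real.exp_pos x)
    have h2 : Real.exp (2 * x) = Real.exp x ^ 2 := by
      rw [← Real.exp_nat_mul]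
      norm_num
    rw [h2, ← h]
    simp only [Function.comp]
    ring
  · have h1 := abs_macdonald_le β 0 (Real.one_le_exp hx)
    have h2 := abs_macdonald_le β 1 (Real.one_le_exp hx)
    have p : ∀ n, 0 ≤ macdonald 0 n 1 := fun n => by
      refine integral_nonneg fun s => ?_
      have := Real.cosh_pos s
      simp only [zero_mul, Real.cos_zero]
      positivity
    have e : Real.exp (1 - Real.exp x) = Real.exp 1 * Real.exp (-Real.exp x) := by
      rw [← Real.exp_add]
      rfl
    rw [e] at h1 h2
    have q : 0 < Real.exp 1 * Real.exp (-Real.exp x) := by positivity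
    constructor
    · nlinarith [p 1]
    · rw [abs_neg, abs_mul, abs_of_pos (Real.exp_pos x)]
      calc _ ≤ Real.exp x * (macdonald 0 1 1 * (Real.exp 1 * Real.exp (-Real.exp x))) := by gcongr
        _ ≤ Real.exp x * ((macdonald 0 0 1 + macdonald 0 1 1) *
            (Real.exp 1 * Real.exp (-Real.exp x))) := by
          gcongr
          linarith [p 0]
        _ = _ := by ring
  · refine ⟨Real.log (β ^ 2 / 2 + 1), ?_⟩
    simp only
    rw [Real.exp_log (by positivity)]
    exact (macdonald_pos β (by positivity) (by linarith)).ne'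

/-! ### Asymptotics near the threshold -/

/-- Solutions of `g'' = (exp(2x) - β²) g` oscillate at `-∞`, with a nonzero amplitude. -/
theorem exists_oscillation {β : ℝ} (hβ : 0 < β) {g g₁ : ℝ → ℝ} (hg : ∀ x, HasDerivAt g (g₁ x) x)
    (hg₁ : ∀ x, HasDerivAt g₁ ((Real.exp (2 * x) - β ^ 2) * g x) x) (hne : ∃ x, g x ≠ 0) :
    (∀ x, g x ≠ 0 ∨ g₁ x ≠ 0) ∧ ∃ ρ ψ : ℝ, 0 < ρ ∧
      Tendsto (fun x => g₁ x - ρ * Real.cos (β * x + ψ)) atBot (𝓝 0) ∧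
      Tendsto (fun x => β * g x - ρ * Real.sin (β * x + ψ)) atBot (𝓝 0) := by
  let N : ℝ → ℝ := fun x => g₁ x ^ 2 + β ^ 2 * g x ^ 2
  -- A primitive of e^{2x}/β. It stays bounded at -∞, so the energy `N` is confined there between
  -- two positive constants.
  let e : ℝ → ℝ := fun x => Real.exp (2 * x) / (2 * β)
  have he : ∀ x, HasDerivAt e (Real.exp (2 * x) / β) x := by
    intro x
    refine ((((hasDerivAt_id x).const_mul 2).exp).div_const (2 * β)).congr_deriv ?_
    simp
    field_simp
  have hN : ∀ x, HasDerivAt N (2 * Real.exp (2 * x) * (g x * g₁ x)) x := fun x =>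
    (((hg₁ x).pow 2).add (((hg x).pow 2).const_mul (β ^ 2))).congr_deriv (by
      push_cast
      ring)
  have key : ∀ s t, s ≤ t → N t ≤ N s * Real.exp (e t - e s) ∧ N s ≤ N t * Real.exp (e t - e s) := by
    intro s t hst
    refine le_mul_exp_of_abs_deriv_le hst (fun x _ => (hN x).continuousAt.continuousWithinAt)
      (fun x _ => (he x).continuousAt.continuousWithinAt) (fun x _ => hN x) (fun x _ => he x)
      fun x _ => ?_
    have h1 : 2 * |g x * g₁ x| * β ≤ N x := by
      have h2 : 0 ≤ (|g₁ x| - β * |g x|) ^ 2 := sq_nonneg _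
      rw [sub_sq, sq_abs, mul_pow, sq_abs] at h2
      rw [abs_mul]
      simp only [N]
      linarith
    have h3 : |2 * Real.exp (2 * x) * (g x * g₁ x)| = Real.exp (2 * x) * (2 * |g x * g₁ x|) := by
      rw [abs_mul, abs_of_pos (by positivity)]
      ring
    rw [h3, div_mul_eq_mul_div, le_div_iff₀ hβ, mul_assoc]
    gcongr
  obtain ⟨y, hy⟩ := hne
  have hNy : 0 < N y := by
    have : 0 < g y ^ 2 := by positivity
    simp only [N]
    positivity
  have hN0 : ∀ x, 0 ≤ N x := fun x => by
    simp only [N]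
    positivity
  have hpos : ∀ x, 0 < N x := by
    intro x
    refine lt_of_le_of_ne (hN0 x) fun h => ?_
    rcases le_total x y with hxy | hxy
    · have := (key x y hxy).1
      rw [← h, zero_mul] at this
      linarith
    · have := (key y x hxy).2
      rw [← h, zero_mul] at this
      linarith
  have hepos : ∀ x, 0 < e x := fun x => by
    simp only [e]
    positivity
  have hlow : ∀ x ≤ y, N y * Real.exp (-e y) ≤ N x := by
    intro x hx
    have h := (key x y hx).1
    have h2 : N x * Real.exp (e y - e x) ≤ N x * Real.exp (e y) := by
      gcongr
      linarith [hepos x]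
    calc N y * Real.exp (-e y) ≤ N x * Real.exp (e y) * Real.exp (-e y) := by
          gcongr
          exact h.trans h2
      _ = N x := by
          rw [mul_assoc, ← Real.exp_add]
          simp
  have hup : ∀ x ≤ y, N x ≤ N y * Real.exp (e y) := by
    intro x hx
    refine (key x y hx).2.trans ?_
    gcongr
    linarith [hepos x]
  refine ⟨fun x => ?_, ?_⟩
  · by_contra! h
    have := hpos x
    simp [N, h.1, h.2] at this
  -- Variation of constants: the free rotation e^{iβx} is removed from g₁ + iβg. The derivative of
  -- `z` is then O(e^{2x}) at -∞, so `z` has a limit; the modulus of that limit is the amplitude and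
  -- its argument the phase.
  let z : ℝ → ℂ := fun x => (g₁ x + β * g x * Complex.I) * Complex.exp (-(β * x * Complex.I))
  have hz : ∀ x, HasDerivAt z (Real.exp (2 * x) * g x * Complex.exp (-(β * x * Complex.I))) x := by
    intro x
    have h1 : HasDerivAt (fun x : ℝ => (g₁ x : ℂ) + β * g x * Complex.I)
        (((Real.exp (2 * x) - β ^ 2) * g x : ℝ) + β * (g₁ x : ℂ) * Complex.I) x :=
      (hg₁ x).ofReal_comp.add (((hg x).ofReal_comp.const_mul (β : ℂ)).mul_const Complex.I)
    have h2 : HasDerivAt (fun x : ℝ => Complex.exp (-(β * x * Complex.I)))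
        (Complex.exp (-(β * x * Complex.I)) * (-(β * 1 * Complex.I))) x :=
      ((((hasDerivAt_id x).ofReal_comp).const_mul (β : ℂ)).mul_const Complex.I).neg.cexp
    refine (h1.mul h2).congr_deriv ?_
    have := Complex.I_sq
    push_cast
    linear_combination (-(β : ℂ) ^ 2 * g x * Complex.exp (-(β * x * Complex.I))) * this
  have hnexp : ∀ x : ℝ, ‖Complex.exp (-(β * x * Complex.I))‖ = 1 := fun x => by
    have : -((β : ℂ) * x * Complex.I) = ((-(β * x) : ℝ) : ℂ) * Complex.I := by
      push_cast
      ring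
    rw [this, Complex.norm_exp_ofReal_mul_I]
  have hnz : ∀ x, ‖z x‖ ^ 2 = N x := fun x => by
    simp only [z, N]
    rw [norm_mul, hnexp, mul_one, ← Complex.normSq_eq_norm_sq]
    have : (g₁ x : ℂ) + β * g x * Complex.I = (g₁ x : ℂ) + ((β * g x : ℝ) : ℂ) * Complex.I := by
      push_cast
      ring
    rw [this, Complex.normSq_add_mul_I]
    ring
  have hgc : Continuous g := continuous_iff_continuousAt.mpr fun x => (hg x).continuousAt
  have hgb : ∀ x ≤ y, |g x| ≤ Real.sqrt (N y * Real.exp (e y)) / β := by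
    intro x hx
    rw [le_div_iff₀ hβ]
    refine Real.le_sqrt_of_sq_le ?_
    have h1 := hup x hx
    have : (|g x| * β) ^ 2 ≤ N x := by
      rw [mul_pow, sq_abs]
      simp only [N]
      nlinarith [sq_nonneg (g₁ x)]
    linarith
  have hint : IntegrableOn (fun x : ℝ => (Real.exp (2 * x) * g x * Complex.exp (-(β * x * Complex.I)) : ℂ))
      (Set.Iic y) := by
    have h1 : IntegrableOn (fun x : ℝ => Real.exp (2 * x) *
        (Real.sqrt (N y * Real.exp (e y)) / β)) (Set.Iic y) :=
      (integrableOn_exp_mul_Iic (by norm_num) y).mul_const _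
    refine Integrable.mono' h1 ?_ ?_
    · exact (by fun_prop : Continuous fun x : ℝ =>
        (Real.exp (2 * x) * g x * Complex.exp (-(β * x * Complex.I)) : ℂ)).aestronglyMeasurable
    · refine (ae_restrict_mem measurableSet_Iic).mono fun x hx => ?_
      rw [norm_mul, norm_mul, hnexp, mul_one, Complex.norm_real, Complex.norm_real,
        Real.norm_of_nonneg (Real.exp_pos _).le]
      gcongr
      exact hgb x hx
  have hlim := tendsto_limUnder_of_hasDerivAt_of_integrableOn_Iic (fun x _ => hz x) hint
  set w := limUnder atBot z with hw
  have hwpos : 0 < ‖w‖ := by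
    have h1 : Tendsto (fun x => ‖z x‖ ^ 2) atBot (𝓝 (‖w‖ ^ 2)) := hlim.norm.pow 2
    have h2 : N y * Real.exp (-e y) ≤ ‖w‖ ^ 2 := by
      refine ge_of_tendsto h1 ?_
      filter_upwards [Iic_mem_atBot y] with x hx
      rw [hnz]
      exact hlow x hx
    have h3 : 0 < N y * Real.exp (-e y) := by positivity
    refine lt_of_le_of_ne (norm_nonneg _) fun h => ?_
    rw [← h] at h2
    norm_num at h2
    linarith
  have hd : Tendsto (fun x : ℝ => (g₁ x + β * g x * Complex.I) - w * Complex.exp (β * x * Complex.I))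
      atBot (𝓝 0) := by
    rw [tendsto_zero_iff_norm_tendsto_zero]
    have h1 : Tendsto (fun x => ‖z x - w‖) atBot (𝓝 0) := by
      simpa using (hlim.sub_const w).norm
    refine h1.congr fun x => ?_
    have h2 : z x - w = ((g₁ x + β * g x * Complex.I) - w * Complex.exp (β * x * Complex.I)) *
        Complex.exp (-(β * x * Complex.I)) := by
      simp only [z]
      rw [sub_mul, mul_assoc w, ← Complex.exp_add]
      simp
    rw [h2, norm_mul, hnexp, mul_one]
  have hpolar : ∀ x : ℝ, w * Complex.exp (β * x * Complex.I) =
      ((‖w‖ * Real.cos (β * x + w.arg) : ℝ) : ℂ) + ((‖w‖ * Real.sin (β * x + w.arg) : ℝ) : ℂ) *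
        Complex.I := by
    intro x
    conv_lhs => rw [← Complex.norm_mul_exp_arg_mul_I w]
    rw [mul_assoc, ← Complex.exp_add, ← add_mul, add_comm, Complex.exp_mul_I]
    push_cast
    ring
  have hform : ∀ x : ℝ, (g₁ x + β * g x * Complex.I : ℂ) - w * Complex.exp (β * x * Complex.I) =
      ((g₁ x - ‖w‖ * Real.cos (β * x + w.arg) : ℝ) : ℂ) +
      ((β * g x - ‖w‖ * Real.sin (β * x + w.arg) : ℝ) : ℂ) * Complex.I := by
    intro x
    rw [hpolar]
    push_cast
    ring
  refine ⟨‖w‖, w.arg, hwpos, ?_, ?_⟩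
  · have := (Complex.continuous_re.tendsto _).comp hd
    refine this.congr fun x => ?_
    simp only [Function.comp, hform, Complex.add_re, Complex.re_ofReal_mul, Complex.ofReal_re,
      Complex.I_re, mul_zero, add_zero]
  · have := (Complex.continuous_im.tendsto _).comp hd
    refine this.congr fun x => ?_
    simp only [Function.comp, hform, Complex.add_im, Complex.im_ofReal_mul, Complex.ofReal_im,
      Complex.I_im, mul_one, zero_add]

/-! ### The effective potential near the origin -/

/-- In a = e^{-s} - s both summands decrease in s, so a changes at least as much as s does. -/
theorem abs_lambertGap_sub_le (a b : ℝ) : |lambertGap a - lambertGap b| ≤ |a - b| := by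
  have key : ∀ a b : ℝ, lambertGap a ≤ lambertGap b →
      |lambertGap a - lambertGap b| ≤ |a - b| := by
    intro a b h
    have ha := exp_neg_lambertGap_sub a
    have hb := exp_neg_lambertGap_sub b
    have := Real.exp_le_exp.mpr (neg_le_neg h)
    rw [abs_of_nonpos (by linarith), abs_of_nonneg (by linarith)]
    linarith
  rcases le_total (lambertGap a) (lambertGap b) with h | h
  · exact key a b h
  · rw [abs_sub_comm, abs_sub_comm a]
    exact key b a h

theorem continuous_lambertGap : Continuous lambertGap := by
  have : LipschitzWith 1 lambertGap := LipschitzWith.of_dist_le_mul fun a b => by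
    simpa [Real.dist_eq] using abs_lambertGap_sub_le a b
  exact this.continuous

theorem lambertGap_one : lambertGap 1 = 0 := (lambertGap_eq_iff 1 0).mpr (by simp)

theorem lambertGap_zero : lambertGap 0 = lambertW 1 := by simp [lambertGap]

/-- The inverse function e^{-s} - s has derivative -2 at s = 0. Differentiability here makes the
factor 1/r² in the effective potential harmless at the origin. -/
theorem hasDerivAt_lambertGap_one : HasDerivAt lambertGap (-2)⁻¹ 1 := by
  refine HasDerivAt.of_local_left_inverse (f := fun s : ℝ => Real.exp (-s) - s)
    continuous_lambertGap.continuousAt ?_ (by norm_num)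
    (Eventually.of_forall exp_neg_lambertGap_sub)
  rw [lambertGap_one]
  refine ((hasDerivAt_neg (0 : ℝ)).exp.sub (hasDerivAt_id (0 : ℝ))).congr_deriv ?_
  norm_num

/-- The effective potential is bounded, and continuous up to the origin. -/
theorem exists_continuous_potential {μ ν : ℝ} (hμ : 0 < μ) (hν : 0 < ν) {θ : ℝ → ℝ}
    (hθ : ContDiffOn ℝ ((⊤ : ℕ∞) : WithTop ℕ∞) θ (Set.Ici 0)) (hθ0 : θ 0 = 1)
    {r₀ : ℝ} (hr₀ : 0 < r₀) (hθs : ∀ r : ℝ, r₀ ≤ r → θ r = 0) :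
    ∃ (Q : ℝ → ℝ) (K : ℝ), Continuous Q ∧ (∀ r, |Q r| ≤ K) ∧
      (∀ r, 0 < r → Q r = -(μ * effPotential ν θ r)) ∧
      ∀ r, r₀ ≤ r → Q r = μ / ν * lambertW 1 ^ 2 / r ^ 2 := by
  have hd : DifferentiableWithinAt ℝ θ (Set.Ici 0) 0 :=
    (hθ.differentiableOn (by simp)) 0 Set.self_mem_Ici
  have hh0 : lambertGap (θ 0) = 0 := by rw [hθ0, lambertGap_one]
  have hh : HasDerivWithinAt (fun r => lambertGap (θ r))
      ((-2)⁻¹ * derivWithin θ (Set.Ici 0) 0) (Set.Ici 0) 0 :=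
    HasDerivAt.comp_hasDerivWithinAt_of_eq (h₂ := lambertGap) 0 hasDerivAt_lambertGap_one
      hd.hasDerivWithinAt hθ0.symm
  set c : ℝ := (-2)⁻¹ * derivWithin θ (Set.Ici 0) 0
  -- The singularity at 0 is removable: the numerator vanishes there because θ(0) = 1, and `c` is
  -- its one-sided derivative.
  let S : ℝ → ℝ := Function.update (fun r => lambertGap (θ r) / r) 0 c
  have hSc : ContinuousOn S (Set.Ici 0) := by
    refine continuousOn_update_iff.mpr ⟨?_, fun _ => ?_⟩
    · exact (continuous_lambertGap.comp_continuousOn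
        (hθ.continuousOn.mono Set.sdiff_subset)).div continuousOn_id fun r hr => hr.2
    · refine (hasDerivWithinAt_iff_tendsto_slope.mp hh).congr fun r => ?_
      rw [slope_def_field, hh0, sub_zero, sub_zero]
  have hSr : ∀ r, 0 < r → S r = lambertGap (θ r) / r := fun r hr =>
    Function.update_of_ne hr.ne' _ _
  have hQc : Continuous fun r => μ / ν * S (max r 0) ^ 2 := by
    have : Continuous fun r => S (max r 0) :=
      hSc.comp_continuous (by fun_prop) fun r => le_max_right r 0
    exact continuous_const.mul (this.pow 2)
  have hQ : ∀ r, 0 < r → μ / ν * S (max r 0) ^ 2 = -(μ * effPotential ν θ r) := by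
    intro r hr
    rw [max_eq_left hr.le, hSr r hr, effPotential_eq]
    field_simp
  have hQ0 : ∀ r, r₀ ≤ r → μ / ν * S (max r 0) ^ 2 = μ / ν * lambertW 1 ^ 2 / r ^ 2 := by
    intro r hr
    have hr' : 0 < r := hr₀.trans_le hr
    rw [max_eq_left hr'.le, hSr r hr', hθs r hr, lambertGap_zero]
    field_simp
  obtain ⟨B, hB⟩ := (isCompact_Icc (a := (0 : ℝ)) (b := r₀)).exists_bound_of_continuousOn
    hQc.continuousOn
  have hB0 : 0 ≤ B := (norm_nonneg _).trans (hB 0 ⟨le_rfl, hr₀.le⟩)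
  refine ⟨_, B + μ / ν * lambertW 1 ^ 2 / r₀ ^ 2, hQc, fun r => ?_, hQ, hQ0⟩
  have hp : 0 ≤ μ / ν * lambertW 1 ^ 2 / r₀ ^ 2 := by positivity
  rcases le_total r r₀ with h | h
  · have := hB (max r 0) ⟨le_max_right _ _, max_le h hr₀.le⟩
    rw [max_eq_left (le_max_right r 0), Real.norm_eq_abs] at this
    linarith
  · rw [hQ0 r h, abs_of_nonneg (by positivity)]
    have : μ / ν * lambertW 1 ^ 2 / r ^ 2 ≤ μ / ν * lambertW 1 ^ 2 / r₀ ^ 2 := by gcongr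
    linarith

/-! ### Zeros of asymptotically oscillating functions -/

/-- Around each far zero of the cosine, `D` changes sign on a window of half-width π/(4β), once the
error is below the size C sin(π/4) of the cosine term at the window's ends. The error at the chosen
zeros tends to 0, which forces them towards the zeros of the cosine. `D` may have further zeros; one
per window is enough. -/
theorem exists_zeros_of_oscillation {D : ℝ → ℝ} (hD : Continuous D) {C β φ : ℝ} (hC : 0 < C)
    (hβ : 0 < β) (h : Tendsto (fun x => D x - C * Real.cos (β * x + φ)) atBot (𝓝 0)) (T : ℝ) :
    ∃ z : ℕ → ℝ, StrictAnti z ∧ (∀ n, D (z n) = 0 ∧ z n ≤ T) ∧ Tendsto z atTop atBot ∧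
      Tendsto (fun n => z n - z (n + 1)) atTop (𝓝 (Real.pi / β)) := by
  have hπ := Real.pi_pos
  let c : ℕ → ℝ := fun n => (Real.pi / 2 - φ - n * Real.pi) / β
  have hcos : ∀ n s, Real.cos (β * (c n + s) + φ) = (-1) ^ n * -Real.sin (β * s) := by
    intro n s
    have : β * (c n + s) + φ = (β * s + Real.pi / 2) - n * Real.pi := by
      simp only [c]
      field_simp
      ring
    rw [this, Real.cos_sub_nat_mul_pi, Real.cos_add_pi_div_two]
  have hc1 : ∀ n, c n - c (n + 1) = Real.pi / β := by
    intro n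
    simp only [c]
    push_cast
    field_simp
    ring
  have hcbot : Tendsto c atTop atBot := by
    refine Tendsto.atBot_div_const hβ ?_
    refine tendsto_atBot_add_const_left _ (Real.pi / 2 - φ) ?_ |>.congr (fun n => (sub_eq_add_neg _ _).symm)
    exact tendsto_neg_atTop_atBot.comp (tendsto_natCast_atTop_atTop.atTop_mul_const hπ)
  obtain ⟨X, hX⟩ : ∃ X, ∀ x ≤ X, |D x - C * Real.cos (β * x + φ)| < C * Real.sin (Real.pi / 4) := by
    have hs : 0 < C * Real.sin (Real.pi / 4) :=
      mul_pos hC (Real.sin_pos_of_pos_of_lt_pi (by positivity) (by linarith))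
    have := (tendsto_zero_iff_abs_tendsto_zero _).mp h |>.eventually (gt_mem_nhds hs)
    exact eventually_atBot.mp this
  set d : ℝ := Real.pi / 4 / β with hd
  have hd0 : 0 < d := by positivity
  have hβd : β * d = Real.pi / 4 := by
    rw [hd]
    field_simp
  -- Subtracting `d` keeps the whole window to the left of both `X` and `T`.
  obtain ⟨n₀, hn₀⟩ : ∃ n₀, ∀ n ≥ n₀, c n ≤ min X T - d :=
    eventually_atTop.mp (hcbot.eventually (eventually_le_atBot _))
  have hex : ∀ n ≥ n₀, ∃ s ∈ Set.Icc (-d) d, D (c n + s) = 0 := by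
    intro n hn
    have hcn := hn₀ n hn
    have hXm := min_le_left X T
    let F : ℝ → ℝ := fun s => (-1) ^ n * D (c n + s)
    have hFc : ContinuousOn F (Set.Icc (-d) d) := by
      have : Continuous F := by fun_prop
      exact this.continuousOn
    have hsq : ((-1 : ℝ) ^ n) * (-1) ^ n = 1 := by
      rw [← mul_pow]
      norm_num
    have hF : ∀ s ≤ d, |F s + C * Real.sin (β * s)| < C * Real.sin (Real.pi / 4) := by
      intro s hs
      have h1 := hX (c n + s) (by linarith)
      have h2 : F s + C * Real.sin (β * s) =
          (-1) ^ n * (D (c n + s) - C * Real.cos (β * (c n + s) + φ)) := by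
        rw [hcos]
        simp only [F]
        linear_combination (-C * Real.sin (β * s)) * hsq
      rw [h2, abs_mul, abs_neg_one_pow, one_mul]
      exact h1
    have e1 := hF d le_rfl
    have e2 := hF (-d) (by linarith)
    rw [hβd] at e1
    rw [mul_neg, hβd, Real.sin_neg] at e2
    have f1 := (abs_lt.mp e1).2
    have f2 := (abs_lt.mp e2).1
    obtain ⟨s, hs, hs0⟩ := intermediate_value_Icc' (by linarith : -d ≤ d) hFc
      (show (0 : ℝ) ∈ Set.Icc (F d) (F (-d)) from ⟨by linarith, by linarith⟩)
    refine ⟨s, hs, ?_⟩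
    have : (-1 : ℝ) ^ n * (F s) = D (c n + s) := by
      simp only [F]
      rw [← mul_assoc, hsq, one_mul]
    rw [← this, hs0, mul_zero]
  choose! s hs hs0 using hex
  have hz : Tendsto (fun n => c (n + n₀) + s (n + n₀)) atTop atBot := by
    refine tendsto_atBot_mono (fun n => ?_) (tendsto_atBot_add_const_right _ d
      (hcbot.comp (tendsto_add_atTop_nat n₀)))
    have := (hs (n + n₀) (Nat.le_add_left _ _)).2
    simp only [Function.comp]
    linarith
  have hs_lim : Tendsto (fun n => s (n + n₀)) atTop (𝓝 0) := by
    have h1 := (tendsto_zero_iff_abs_tendsto_zero _).mp (h.comp hz)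
    have h2 : Tendsto (fun n => Real.pi / (2 * (β * C)) * |D (c (n + n₀) + s (n + n₀)) -
        C * Real.cos (β * (c (n + n₀) + s (n + n₀)) + φ)|) atTop (𝓝 0) := by
      simpa using h1.const_mul (Real.pi / (2 * (β * C)))
    refine squeeze_zero_norm (fun n => ?_) h2
    have hm := hs (n + n₀) (Nat.le_add_left _ _)
    rw [hs0 _ (Nat.le_add_left _ _), hcos, zero_sub, abs_neg, abs_mul, abs_mul, abs_neg_one_pow,
      one_mul, abs_neg, abs_of_pos hC, Real.norm_eq_abs]
    have h3 : |β * s (n + n₀)| ≤ Real.pi / 2 := by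
      rw [abs_mul, abs_of_pos hβ]
      have : |s (n + n₀)| ≤ d := abs_le.mpr hm
      calc _ ≤ β * d := by gcongr
        _ ≤ _ := by
          rw [hβd]
          linarith
    -- Jordan's inequality |sin x| ≥ (2/π)|x| turns the error bound into a bound on the offset of
    -- the zero.
    have h4 := Real.mul_abs_le_abs_sin h3
    rw [abs_mul, abs_of_pos hβ] at h4
    calc |s (n + n₀)| = Real.pi / (2 * β) * (2 / Real.pi * (β * |s (n + n₀)|)) := by field_simp
      _ ≤ Real.pi / (2 * β) * |Real.sin (β * s (n + n₀))| := by gcongr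
      _ = _ := by field_simp
  refine ⟨fun n => c (n + n₀) + s (n + n₀), strictAnti_nat_of_succ_lt fun n => ?_, fun n => ⟨?_, ?_⟩,
    hz, ?_⟩
  · have h1 := (hs (n + n₀) (Nat.le_add_left _ _)).1
    have h2 := (hs (n + 1 + n₀) (Nat.le_add_left _ _)).2
    have h3 := hc1 (n + n₀)
    -- Consecutive windows are disjoint, so the chosen zeros are strictly ordered.
    have h4 : 2 * d < Real.pi / β := by
      rw [hd, lt_div_iff₀ hβ]
      field_simp
      norm_num
    rw [show n + 1 + n₀ = n + n₀ + 1 by ring] at h2 ⊢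
    linarith
  · exact hs0 _ (Nat.le_add_left _ _)
  · have h1 := (hs (n + n₀) (Nat.le_add_left _ _)).2
    have h2 := hn₀ (n + n₀) (Nat.le_add_left _ _)
    have h3 := min_le_right X T
    linarith
  · have h1 := (hs_lim.sub (hs_lim.comp (tendsto_add_atTop_nat 1))).const_add (Real.pi / β)
    simp only [sub_zero, add_zero] at h1
    refine h1.congr fun n => ?_
    have h3 := hc1 (n + n₀)
    simp only [Function.comp]
    rw [show n + 1 + n₀ = n + n₀ + 1 by ring]
    linarith

/-! ### Radial eigenfunctions -/

theorem abs_le_mul_of_abs_deriv_le {χ χ₁ : ℝ → ℝ} {C : ℝ} (hχ : Continuous χ) (h0 : χ 0 = 0)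
    (h1 : ∀ r, 0 < r → HasDerivAt χ (χ₁ r) r) (b1 : ∀ r, 0 < r → |χ₁ r| ≤ C) {r : ℝ} (hr : 0 < r) :
    |χ r| ≤ C * r := by
  obtain ⟨c, hc, he⟩ := exists_hasDerivAt_eq_slope χ χ₁ hr hχ.continuousOn (fun x hx => h1 x hx.1)
  rw [h0, sub_zero, sub_zero, eq_div_iff hr.ne'] at he
  rw [← he, abs_mul, abs_of_pos hr]
  exact mul_le_mul_of_nonneg_right (b1 c hc.1) hr.le

/-- A decaying solution of the radial equation that vanishes at the origin gives an eigenvalue. -/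
theorem isEigenvalue_slowHamiltonian {μ l : ℝ} (hμ : 0 < μ) {V Q : ℝ → ℝ} {K : ℝ}
    (hQ : Continuous Q) (hK : ∀ r, |Q r| ≤ K) (hQV : ∀ r, 0 < r → Q r = -(μ * V r))
    {χ χ₁ : ℝ → ℝ} (hχ : Continuous χ) (hχ₁ : Continuous χ₁) (h0 : χ 0 = 0) (h10 : χ₁ 0 = 1)
    (h1 : ∀ r, 0 < r → HasDerivAt χ (χ₁ r) r)
    (h2 : ∀ r, 0 < r → HasDerivAt χ₁ ((l - Q r) * χ r) r) {C k : ℝ} (hk : 0 < k)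
    (hb : ∀ r, 0 < r → |χ r| ≤ C * Real.exp (-(k * r)) ∧ |χ₁ r| ≤ C * Real.exp (-(k * r))) :
    IsEigenvalue (slowHamiltonian μ V) ((-(l / μ) : ℝ) : ℂ) := by
  have hC : 0 ≤ C := by
    have := (abs_nonneg _).trans (hb 1 one_pos).1
    exact nonneg_of_mul_nonneg_left this (Real.exp_pos _)
  have hexp : ∀ r, 0 < r → Real.exp (-(k * r)) ≤ 1 := fun r hr =>
    Real.exp_le_one_iff.mpr (by nlinarith)
  have hb0 : ∀ r, 0 < r → |χ r| ≤ C := fun r hr =>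
    (hb r hr).1.trans (mul_le_of_le_one_right hC (hexp r hr))
  have hb1 : ∀ r, 0 < r → |χ₁ r| ≤ C := fun r hr =>
    (hb r hr).2.trans (mul_le_of_le_one_right hC (hexp r hr))
  have hp : ∀ r, |l - Q r| ≤ |l| + K := fun r => (abs_sub _ _).trans (by linarith [hK r])
  have hp0 : 0 ≤ |l| + K := (abs_nonneg _).trans (hp 0)
  have hsq : IntegrableOn (fun r => Real.exp (-(2 * k * r))) (Set.Ioi 0) := by
    simpa using exp_neg_integrableOn_Ioi 0 (b := 2 * k) (by positivity)
  have hsqe : ∀ r, Real.exp (-(k * r)) ^ 2 = Real.exp (-(2 * k * r)) := fun r => by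
    rw [← Real.exp_nat_mul]
    congr 1
    push_cast
    ring
  have hint : ∀ (f : ℝ → ℝ) (B : ℝ), Continuous f → (∀ r, 0 < r → |f r| ≤ B * Real.exp (-(k * r))) →
      IntegrableOn (fun r => f r ^ 2) (Set.Ioi 0) := by
    intro f B hf hfB
    refine (hsq.const_mul (B ^ 2)).mono' (by fun_prop) ?_
    refine (ae_restrict_mem measurableSet_Ioi).mono fun r hr => ?_
    rw [← hsqe, ← mul_pow, Real.norm_eq_abs, abs_pow]
    exact pow_le_pow_left₀ (abs_nonneg _) (hfB r hr) 2
  have hχ₂c : Continuous fun r => (l - Q r) * χ r := by fun_prop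
  have m0 := memLp_radial hχ.continuousOn (hint χ C hχ fun r hr => (hb r hr).1)
  have m2 := memLp_radial (χ := fun r => (l - Q r) * χ r) hχ₂c.continuousOn
    (hint _ ((|l| + K) * C) hχ₂c fun r hr => by
      rw [abs_mul, mul_assoc]
      exact mul_le_mul (hp r) (hb r hr).1 (abs_nonneg _) hp0)
  set u : L2 := m0.toLp _ with hu
  set w : L2 := m2.toLp _ with hw
  have hue := m0.coeFn_toLp
  have hwe := m2.coeFn_toLp
  rw [← hu] at hue
  rw [← hw] at hwe
  have hΔ : Δ (toDist u) = toDist w := by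
    refine laplacian_toDist_radial (χ := χ) (χ₁ := χ₁) (χ₂ := fun r => (l - Q r) * χ r)
      (C := C + (|l| + K) * C) h1 h2 hχ₂c.continuousOn (fun r hr => ?_) (fun r hr => ?_)
      (fun r hr => ?_) 0 ?_ ?_
    · refine (abs_le_mul_of_abs_deriv_le hχ h0 h1 hb1 hr).trans ?_
      gcongr
      nlinarith
    · have := hb1 r hr
      nlinarith
    · rw [abs_mul]
      have := mul_le_mul (hp r) (hb0 r hr) (abs_nonneg _) hp0
      linarith
    · simpa using hue
    · simpa using hwe
  have hne : u ≠ 0 := by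
    intro h
    -- Since χ'(0) = 1, χ is positive just to the right of 0, on a punctured ball that meets every
    -- set of full measure.
    obtain ⟨δ, hδ, hδ2⟩ : ∃ δ > 0, ∀ r, 0 < r → r < δ → 0 < χ₁ r := by
      have hev : ∀ᶠ r in 𝓝 (0 : ℝ), 0 < χ₁ r :=
        (hχ₁.tendsto 0).eventually (lt_mem_nhds (by rw [h10]; exact one_pos))
      obtain ⟨δ, hδ, hball⟩ := Metric.eventually_nhds_iff.mp hev
      refine ⟨δ, hδ, fun r hr hrδ => hball ?_⟩
      rw [Real.dist_eq, sub_zero, abs_of_pos hr]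
      exact hrδ
    have hpos : ∀ r, 0 < r → r < δ → 0 < χ r := by
      intro r hr hrδ
      obtain ⟨c, hc, he⟩ := exists_hasDerivAt_eq_slope χ χ₁ hr hχ.continuousOn
        (fun x hx => h1 x hx.1)
      rw [h0, sub_zero, sub_zero, eq_div_iff hr.ne'] at he
      rw [← he]
      exact mul_pos (hδ2 c hc.1 (hc.2.trans hrδ)) hr
    have hz : ∀ᵐ x : R3, ((χ ‖x‖ / ‖x‖ : ℝ) : ℂ) = 0 := by
      filter_upwards [hue, Lp.coeFn_zero ℂ 2 (volume : Measure R3)] with x a b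
      rw [← a, h, b]
      rfl
    have hopen : IsOpen (Metric.ball (0 : R3) δ ∩ {0}ᶜ) :=
      Metric.isOpen_ball.inter isOpen_compl_singleton
    have hnonempty : (Metric.ball (0 : R3) δ ∩ {0}ᶜ).Nonempty := by
      have : (𝓝[≠] (0 : R3)).NeBot := inferInstance
      exact this.nonempty_of_mem (inter_mem (mem_nhdsWithin_of_mem_nhds (Metric.ball_mem_nhds _ hδ))
        self_mem_nhdsWithin)
    obtain ⟨x, ⟨hx1, hx2⟩, hx⟩ := (Measure.dense_of_ae hz).inter_open_nonempty _ hopen hnonempty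
    have hxn : 0 < ‖x‖ := norm_pos_iff.mpr hx2
    have h3 := hpos ‖x‖ hxn (by simpa using hx1)
    have h4 : χ ‖x‖ / ‖x‖ = 0 := Complex.ofReal_eq_zero.mp hx
    exact (div_pos h3 hxn).ne' h4
  refine ⟨u, (isEigenvector_iff_mem_graph _ _ _).mpr ⟨hne, ?_⟩⟩
  rw [graph_slowHamiltonian]
  refine ⟨memH2_of_laplacian hΔ, (-((1 / μ : ℝ) : ℂ)) • w, ?_, ?_⟩
  · simp only
    rw [hΔ, ← map_smul, ← map_neg, neg_smul]
  · have hx0 : ∀ᵐ x : R3, x ≠ 0 := by simp [ae_iff]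
    filter_upwards [hue, hwe, hx0, Lp.coeFn_smul (-((1 / μ : ℝ) : ℂ)) w,
      Lp.coeFn_smul ((-(l / μ) : ℝ) : ℂ) u] with x a b c d e
    have hxn : 0 < ‖x‖ := norm_pos_iff.mpr c
    rw [e, d, Pi.smul_apply, Pi.smul_apply, a, b, smul_eq_mul, smul_eq_mul, ← Complex.ofReal_neg,
      ← Complex.ofReal_mul, ← Complex.ofReal_mul, ← Complex.ofReal_mul, ← Complex.ofReal_add,
      Complex.ofReal_inj, hQV _ hxn]
    field_simp
    ring

/-- A solution of the radial equation that matches the decaying exterior solution decays. -/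
theorem exists_exp_bound_of_matching {β ζ r₀ K : ℝ} (hr₀ : 0 < r₀) {Q : ℝ → ℝ}
    (hK : ∀ r, |Q r| ≤ K) (hQ₀ : ∀ r, r₀ ≤ r → Q r = (β ^ 2 + 1 / 4) / r ^ 2)
    {g g₁ : ℝ → ℝ} (hg : ∀ x, HasDerivAt g (g₁ x) x)
    (hg₁ : ∀ x, HasDerivAt g₁ ((Real.exp (2 * x) - β ^ 2) * g x) x)
    (hdec : ∃ C, ∀ x, 0 ≤ x → |g x| ≤ C * Real.exp (-Real.exp x) ∧
      |g₁ x| ≤ C * Real.exp x * Real.exp (-Real.exp x)) (hne : ∀ x, g x ≠ 0 ∨ g₁ x ≠ 0)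
    {χ χ₁ : ℝ → ℝ} (hχ : Continuous χ) (hχ₁ : Continuous χ₁)
    (h1 : ∀ r, 0 < r → HasDerivAt χ (χ₁ r) r)
    (h2 : ∀ r, 0 < r → HasDerivAt χ₁ ((Real.exp (2 * ζ) - Q r) * χ r) r)
    (hm : χ r₀ / Real.sqrt r₀ * g₁ (ζ + Real.log r₀) -
      (Real.sqrt r₀ * χ₁ r₀ - χ r₀ / (2 * Real.sqrt r₀)) * g (ζ + Real.log r₀) = 0) :
    ∃ C k : ℝ, 0 < k ∧
      ∀ r, 0 < r → |χ r| ≤ C * Real.exp (-(k * r)) ∧ |χ₁ r| ≤ C * Real.exp (-(k * r)) := by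
  -- The decaying exterior solution in the variable r; the factor √r accounts for the summand 1/4 in
  -- the inverse-square coupling.
  let f : ℝ → ℝ := fun r => Real.sqrt r * g (ζ + Real.log r)
  let f₁ : ℝ → ℝ := fun r => (g (ζ + Real.log r) / 2 + g₁ (ζ + Real.log r)) / Real.sqrt r
  have hlog : ∀ r, 0 < r → HasDerivAt (fun r => ζ + Real.log r) r⁻¹ r := fun r hr =>
    (Real.hasDerivAt_log hr.ne').const_add ζ
  have hsq : ∀ r : ℝ, 0 < r → Real.sqrt r ^ 2 = r := fun r hr => Real.sq_sqrt hr.le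
  have hf : ∀ r, 0 < r → HasDerivAt f (f₁ r) r := by
    intro r hr
    have hs : 0 < Real.sqrt r := Real.sqrt_pos.mpr hr
    refine ((Real.hasDerivAt_sqrt hr.ne').mul ((hg _).comp r (hlog r hr))).congr_deriv ?_
    simp only [Function.comp, f₁]
    have := hsq r hr
    generalize Real.sqrt r = s at *
    subst this
    field_simp
  have hf₁ : ∀ r, 0 < r → HasDerivAt f₁ ((Real.exp (2 * ζ) - (β ^ 2 + 1 / 4) / r ^ 2) * f r) r := by
    intro r hr
    have hs : 0 < Real.sqrt r := Real.sqrt_pos.mpr hr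
    refine (((((hg _).comp r (hlog r hr)).div_const 2).add ((hg₁ _).comp r (hlog r hr))).div
      (Real.hasDerivAt_sqrt hr.ne') hs.ne').congr_deriv ?_
    have he : Real.exp (2 * (ζ + Real.log r)) = Real.exp (2 * ζ) * r ^ 2 := by
      rw [mul_add, Real.exp_add, two_mul (Real.log r), Real.exp_add, Real.exp_log hr, sq]
    simp only [Function.comp, f, Pi.add_apply]
    rw [he]
    have := hsq r hr
    generalize Real.sqrt r = s at *
    generalize g (ζ + Real.log r) = a
    generalize g₁ (ζ + Real.log r) = b
    subst this
    field_simp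
    ring
  have hs₀ : 0 < Real.sqrt r₀ := Real.sqrt_pos.mpr hr₀
  -- The matching condition `hm` is the vanishing of the Wronskian of χ and `f` at r₀.
  have hW : χ r₀ * f₁ r₀ = χ₁ r₀ * f r₀ := by
    have hq := hsq r₀ hr₀
    simp only [f, f₁]
    generalize Real.sqrt r₀ = s at *
    field_simp at hm ⊢
    linarith
  obtain ⟨c, hc0, hc1⟩ : ∃ c, χ r₀ = c * f r₀ ∧ χ₁ r₀ = c * f₁ r₀ := by
    by_cases hfz : f r₀ = 0
    · have hgz : g (ζ + Real.log r₀) = 0 := by simpa [f, hs₀.ne'] using hfz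
      have hg1 : f₁ r₀ ≠ 0 := by
        have := (hne (ζ + Real.log r₀)).resolve_left (fun h => h hgz)
        simp only [f₁, hgz]
        simp [this, hs₀.ne']
      refine ⟨χ₁ r₀ / f₁ r₀, ?_, (div_mul_cancel₀ _ hg1).symm⟩
      rw [hfz, mul_zero] at hW ⊢
      exact (mul_eq_zero.mp hW).resolve_right hg1
    · refine ⟨χ r₀ / f r₀, (div_mul_cancel₀ _ hfz).symm, ?_⟩
      rw [div_mul_eq_mul_div, hW, mul_div_cancel_right₀ _ hfz]
  have heq : ∀ r, r₀ ≤ r → χ r = c * f r ∧ χ₁ r = c * f₁ r := by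
    intro r hr
    have hposI : ∀ x ∈ Set.Icc r₀ r, 0 < x := fun x hx => hr₀.trans_le hx.1
    have hfc : ContinuousOn f (Set.Icc r₀ r) := fun x hx =>
      (hf x (hposI x hx)).continuousAt.continuousWithinAt
    have hf₁c : ContinuousOn f₁ (Set.Icc r₀ r) := fun x hx =>
      (hf₁ x (hposI x hx)).continuousAt.continuousWithinAt
    -- Uniqueness for r ≥ r₀: the difference χ - cf has zero data at r₀ and solves the same
    -- equation.
    have h := (second_order_bound (f := fun r => χ r - c * f r) (f₁ := fun r => χ₁ r - c * f₁ r)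
      (p := fun r => Real.exp (2 * ζ) - Q r) (K := |Real.exp (2 * ζ)| + K) hr (by fun_prop)
      (by fun_prop)
      (fun x hx => (h1 x (hr₀.trans hx.1)).sub ((hf x (hr₀.trans hx.1)).const_mul c))
      (fun x hx => ((h2 x (hr₀.trans hx.1)).sub
        ((hf₁ x (hr₀.trans hx.1)).const_mul c)).congr_deriv (by
          rw [hQ₀ x hx.1.le]
          ring))
      (fun x _ => (abs_sub _ _).trans (by linarith [hK x]))).1
    simp only [hc0, hc1, sub_self] at h
    norm_num at h
    constructor <;> nlinarith [sq_nonneg (χ r - c * f r), sq_nonneg (χ₁ r - c * f₁ r)]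
  obtain ⟨B, hB⟩ := hdec
  have hB0 : 0 ≤ B := by
    have := (abs_nonneg _).trans (hB 0 le_rfl).1
    exact nonneg_of_mul_nonneg_left this (Real.exp_pos _)
  set κ := Real.exp ζ with hκ
  have hκ0 : 0 < κ := Real.exp_pos _
  -- Beyond `R` the solutions agree up to the factor `c`, √r lies between 1 and r, and ζ + log r ≥
  -- 0, where the decay bound for `g` applies.
  set R := max r₀ (max 1 κ⁻¹) with hR
  have hR1 : 1 ≤ R := (le_max_left _ _).trans (le_max_right _ _)
  have hR2 : κ⁻¹ ≤ R := (le_max_right _ _).trans (le_max_right _ _)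
  have hfar : ∀ r, R ≤ r → |f r| ≤ B * (2 / κ) * Real.exp (-(κ / 2 * r)) ∧
      |f₁ r| ≤ B * 3 * Real.exp (-(κ / 2 * r)) := by
    intro r hr
    have hr1 : 1 ≤ r := hR1.trans hr
    have hr0 : 0 < r := by linarith
    have hκr : 1 ≤ κ * r := by
      have := mul_le_mul_of_nonneg_left (hR2.trans hr) hκ0.le
      rwa [mul_inv_cancel₀ hκ0.ne'] at this
    have hx : Real.exp (ζ + Real.log r) = κ * r := by rw [Real.exp_add, Real.exp_log hr0]
    have hx0 : 0 ≤ ζ + Real.log r := by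
      rw [← Real.log_exp (ζ + Real.log r), hx]
      exact Real.log_nonneg hκr
    obtain ⟨b0, b1⟩ := hB _ hx0
    rw [hx] at b0 b1
    have hs1 : 1 ≤ Real.sqrt r := Real.one_le_sqrt.mpr hr1
    have hsr : Real.sqrt r ≤ r := Real.sqrt_le_iff.mpr ⟨hr0.le, by nlinarith⟩
    have hee : Real.exp (-(κ * r)) = Real.exp (-(κ / 2 * r)) * Real.exp (-(κ / 2 * r)) := by
      rw [← Real.exp_add]
      congr 1
      ring
    -- Half of the decay e^{-κr} is spent on the growing factor r; the rate κ/2 remains.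
    have hye : κ / 2 * r * Real.exp (-(κ / 2 * r)) ≤ 1 := by
      rw [Real.exp_neg, ← div_eq_mul_inv, div_le_one (Real.exp_pos _)]
      linarith [Real.add_one_le_exp (κ / 2 * r)]
    set t := Real.exp (-(κ / 2 * r)) with ht
    have ht0 : 0 < t := Real.exp_pos _
    have ht1 : t ≤ 1 := Real.exp_le_one_iff.mpr (by
      have : 0 < κ / 2 * r := by positivity
      linarith)
    rw [hee] at b0 b1
    constructor
    · simp only [f]
      rw [abs_mul, abs_of_pos (by linarith)]
      calc Real.sqrt r * |g (ζ + Real.log r)| ≤ r * (B * (t * t)) := by gcongr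
        _ = B * (2 / κ) * (κ / 2 * r * t) * t := by field_simp
        _ ≤ B * (2 / κ) * 1 * t := by gcongr
        _ = _ := by ring
    · simp only [f₁]
      rw [abs_div, abs_of_pos (by linarith : 0 < Real.sqrt r)]
      refine (div_le_self (abs_nonneg _) hs1).trans ((abs_add_le _ _).trans ?_)
      rw [abs_div, abs_two]
      have e1 : B * (t * t) ≤ B * t := by
        have := mul_le_mul_of_nonneg_left ht1 ht0.le
        nlinarith
      have e2 : B * (κ * r) * (t * t) ≤ 2 * (B * t) := by
        calc B * (κ * r) * (t * t) = 2 * (B * t) * (κ / 2 * r * t) := by ring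
          _ ≤ 2 * (B * t) * 1 := by gcongr
          _ = _ := by ring
      have e3 : 0 ≤ B * t := by positivity
      linarith
  obtain ⟨M₀, hM₀⟩ := (isCompact_Icc (a := (0 : ℝ)) (b := R)).exists_bound_of_continuousOn
    hχ.continuousOn
  obtain ⟨M₁, hM₁⟩ := (isCompact_Icc (a := (0 : ℝ)) (b := R)).exists_bound_of_continuousOn
    hχ₁.continuousOn
  have hR0 : 0 ≤ R := by linarith
  have hM₀0 : 0 ≤ M₀ := (norm_nonneg _).trans (hM₀ 0 ⟨le_rfl, hR0⟩)
  have hM₁0 : 0 ≤ M₁ := (norm_nonneg _).trans (hM₁ 0 ⟨le_rfl, hR0⟩)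
  have hE : 0 < Real.exp (κ / 2 * R) := Real.exp_pos _
  refine ⟨(M₀ + M₁) * Real.exp (κ / 2 * R) + |c| * (B * (2 / κ) + B * 3), κ / 2, by positivity,
    fun r hr => ?_⟩
  have ht0 : 0 < Real.exp (-(κ / 2 * r)) := Real.exp_pos _
  have hp1 : 0 ≤ |c| * (B * (2 / κ)) := by positivity
  have hp2 : 0 ≤ |c| * (B * 3) := by positivity
  have hp3 := mul_nonneg hM₀0 hE.le
  have hp4 := mul_nonneg hM₁0 hE.le
  rcases le_total r R with h | h
  · have h3 : 1 ≤ Real.exp (κ / 2 * R) * Real.exp (-(κ / 2 * r)) := by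
      rw [← Real.exp_add]
      refine Real.one_le_exp ?_
      have := mul_le_mul_of_nonneg_left h (by positivity : 0 ≤ κ / 2)
      linarith
    have a0 := hM₀ r ⟨hr.le, h⟩
    have a1 := hM₁ r ⟨hr.le, h⟩
    rw [Real.norm_eq_abs] at a0 a1
    have key : ∀ M : ℝ, 0 ≤ M → M ≤ M₀ + M₁ → M ≤ ((M₀ + M₁) * Real.exp (κ / 2 * R) +
        |c| * (B * (2 / κ) + B * 3)) * Real.exp (-(κ / 2 * r)) := by
      intro M hM hM'
      calc M ≤ (M₀ + M₁) * (Real.exp (κ / 2 * R) * Real.exp (-(κ / 2 * r))) := by nlinarith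
        _ = (M₀ + M₁) * Real.exp (κ / 2 * R) * Real.exp (-(κ / 2 * r)) := by ring
        _ ≤ _ := by
          gcongr
          linarith
    exact ⟨a0.trans (key _ hM₀0 (by linarith)), a1.trans (key _ hM₁0 (by linarith))⟩
  · obtain ⟨e0, e1⟩ := heq r ((le_max_left _ _).trans h)
    obtain ⟨b0, b1⟩ := hfar r h
    rw [e0, e1, abs_mul c (f r), abs_mul c (f₁ r)]
    constructor
    · calc |c| * |f r| ≤ |c| * (B * (2 / κ) * Real.exp (-(κ / 2 * r))) := by gcongr
        _ = |c| * (B * (2 / κ)) * Real.exp (-(κ / 2 * r)) := by ring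
        _ ≤ _ := mul_le_mul_of_nonneg_right (by linarith) ht0.le
    · calc |c| * |f₁ r| ≤ |c| * (B * 3 * Real.exp (-(κ / 2 * r))) := by gcongr
        _ = |c| * (B * 3) * Real.exp (-(κ / 2 * r)) := by ring
        _ ≤ _ := mul_le_mul_of_nonneg_right (by linarith) ht0.le

/-! ### Matching -/

theorem exists_amplitude_phase {a b : ℝ} (h : a ≠ 0 ∨ b ≠ 0) : ∃ R δ : ℝ, 0 < R ∧
    ∀ x, a * Real.cos x - b * Real.sin x = R * Real.cos (x + δ) := by
  set w : ℂ := ⟨a, b⟩ with hw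
  have hw0 : w ≠ 0 := by
    intro h0
    rcases h with h | h
    · exact h (congrArg Complex.re h0)
    · exact h (congrArg Complex.im h0)
  refine ⟨‖w‖, w.arg, norm_pos_iff.mpr hw0, fun x => ?_⟩
  have h1 : ‖w‖ * Real.cos w.arg = a := Complex.norm_mul_cos_arg w
  have h2 : ‖w‖ * Real.sin w.arg = b := Complex.norm_mul_sin_arg w
  rw [Real.cos_add, ← h1, ← h2]
  ring

/-- The Wronskian at r₀ is studied as a function of ζ, with l = e^{2ζ}. As ζ → -∞ its interior
factors converge by continuity in l, while the exterior ones oscillate with frequency β; its zeros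
are the required z. -/
theorem exists_matching_sequence {β r₀ K : ℝ} (hβ : 0 < β) (hr₀ : 0 < r₀) {Q : ℝ → ℝ}
    (hQ : Continuous Q) (hK : ∀ r, |Q r| ≤ K)
    (hQ₀ : ∀ r, r₀ ≤ r → Q r = (β ^ 2 + 1 / 4) / r ^ 2) :
    ∃ z : ℕ → ℝ, StrictAnti z ∧ Tendsto z atTop atBot ∧
      Tendsto (fun n => z n - z (n + 1)) atTop (𝓝 (Real.pi / β)) ∧
      ∀ n, ∃ χ χ₁ : ℝ → ℝ, Continuous χ ∧ Continuous χ₁ ∧ χ 0 = 0 ∧ χ₁ 0 = 1 ∧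
        (∀ r, 0 < r → HasDerivAt χ (χ₁ r) r) ∧
        (∀ r, 0 < r → HasDerivAt χ₁ ((Real.exp (2 * z n) - Q r) * χ r) r) ∧
        ∃ C k : ℝ, 0 < k ∧
          ∀ r, 0 < r → |χ r| ≤ C * Real.exp (-(k * r)) ∧ |χ₁ r| ≤ C * Real.exp (-(k * r)) := by
  obtain ⟨g, g₁, hg, hg₁, hdec, hne⟩ := exists_decaying_solution β
  obtain ⟨hne', ρ, ψ, hρ, hosc₁, hosc⟩ := exists_oscillation hβ hg hg₁ hne
  -- Clamping the parameter to [0, 1] makes the coefficient bounded for all parameters. It changes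
  -- nothing at the zeros used, which satisfy z ≤ 0 and hence e^{2z} ≤ 1.
  have hp : ∀ z : ℝ × ℝ, |max 0 (min z.2 1) - Q z.1| ≤ 1 + K := by
    intro z
    refine (abs_sub _ _).trans (add_le_add ?_ (hK _))
    rw [abs_of_nonneg (le_max_left _ _)]
    exact max_le zero_le_one (min_le_right _ _)
  obtain ⟨χ, χ₁, hχ, hχ₁, h0, h10, hd⟩ := exists_second_order_solution
    (p := fun z => max 0 (min z.2 1) - Q z.1) (by fun_prop) hp
  have hs₀ : 0 < Real.sqrt r₀ := Real.sqrt_pos.mpr hr₀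
  -- For χ = √r v(log r), `a` and `b` are the values of v and v' at log r₀.
  let a : ℝ → ℝ := fun l => χ (r₀, l) / Real.sqrt r₀
  let b : ℝ → ℝ := fun l => Real.sqrt r₀ * χ₁ (r₀, l) - χ (r₀, l) / (2 * Real.sqrt r₀)
  have ha : Continuous a := by
    simp only [a]
    fun_prop
  have hb : Continuous b := by
    simp only [b]
    fun_prop
  -- If both data vanished at r₀ for l = 0, the backward estimate would contradict χ₁(0) = 1.
  have hab : a 0 ≠ 0 ∨ b 0 / β ≠ 0 := by
    by_contra! h
    have e1 : χ (r₀, 0) = 0 := by simpa [a, hs₀.ne'] using h.1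
    have e2 : χ₁ (r₀, 0) = 0 := by simpa [b, hs₀.ne', hβ.ne', e1] using h.2
    have := (second_order_bound (f := fun t => χ (t, 0)) (f₁ := fun t => χ₁ (t, 0))
      (p := fun t => max 0 (min 0 1) - Q t) (K := 1 + K) hr₀.le (by fun_prop) (by fun_prop)
      (fun x hx => (hd 0 x hx.1).1) (fun x hx => (hd 0 x hx.1).2) (fun x _ => hp (x, 0))).2
    simp only [e1, e2, h0, h10] at this
    norm_num at this
  obtain ⟨R, δ, hR, hamp⟩ := exists_amplitude_phase hab
  let D : ℝ → ℝ := fun ζ => a (Real.exp (2 * ζ)) * g₁ (ζ + Real.log r₀) -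
    b (Real.exp (2 * ζ)) * g (ζ + Real.log r₀)
  have hgc : Continuous g := continuous_iff_continuousAt.mpr fun x => (hg x).continuousAt
  have hgc₁ : Continuous g₁ := continuous_iff_continuousAt.mpr fun x => (hg₁ x).continuousAt
  have hDc : Continuous D := by
    simp only [D]
    fun_prop
  have hshift : Tendsto (fun ζ => ζ + Real.log r₀) atBot atBot :=
    tendsto_atBot_add_const_right _ _ tendsto_id
  have hl : Tendsto (fun ζ : ℝ => Real.exp (2 * ζ)) atBot (𝓝 0) :=
    Real.tendsto_exp_atBot.comp (tendsto_id.const_mul_atBot two_pos)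
  have hD : Tendsto (fun ζ => D ζ - ρ * R * Real.cos (β * ζ + (β * Real.log r₀ + ψ + δ))) atBot
      (𝓝 0) := by
    have t1 := (ha.tendsto 0).comp hl
    have t2 := ((hb.tendsto 0).comp hl).div_const β
    have o1 := hosc₁.comp hshift
    have o2 := hosc.comp hshift
    have c1 : Tendsto (fun ζ => (a (Real.exp (2 * ζ)) - a 0) *
        (ρ * Real.cos (β * (ζ + Real.log r₀) + ψ))) atBot (𝓝 0) := by
      refine Tendsto.zero_mul_isBoundedUnder_le (by simpa using t1.sub_const (a 0)) ?_
      refine isBoundedUnder_of ⟨ρ, fun ζ => ?_⟩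
      simp only [Function.comp]
      rw [norm_mul, Real.norm_of_nonneg hρ.le, Real.norm_eq_abs]
      exact mul_le_of_le_one_right hρ.le (Real.abs_cos_le_one _)
    have c2 : Tendsto (fun ζ => (b (Real.exp (2 * ζ)) / β - b 0 / β) *
        (ρ * Real.sin (β * (ζ + Real.log r₀) + ψ))) atBot (𝓝 0) := by
      refine Tendsto.zero_mul_isBoundedUnder_le (by simpa using t2.sub_const (b 0 / β)) ?_
      refine isBoundedUnder_of ⟨ρ, fun ζ => ?_⟩
      simp only [Function.comp]
      rw [norm_mul, Real.norm_of_nonneg hρ.le, Real.norm_eq_abs]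
      exact mul_le_of_le_one_right hρ.le (Real.abs_sin_le_one _)
    -- The first part replaces g₁ and βg by their asymptotic cosine and sine; `c1` and `c2` then
    -- replace the coefficients by their values at l = 0.
    have key := ((t1.mul o1).sub (t2.mul o2)).add (c1.sub c2)
    simp only [mul_zero, sub_zero, add_zero] at key
    refine key.congr fun ζ => ?_
    have h3 := hamp (β * (ζ + Real.log r₀) + ψ)
    have h4 : β * ζ + (β * Real.log r₀ + ψ + δ) = β * (ζ + Real.log r₀) + ψ + δ := by ring
    rw [h4, mul_assoc, ← h3]
    simp only [Function.comp, D]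
    field_simp
    ring
  obtain ⟨z, hz, hz0, hzbot, hzd⟩ := exists_zeros_of_oscillation hDc (mul_pos hρ hR) hβ hD 0
  refine ⟨z, hz, hzbot, hzd, fun n => ⟨fun t => χ (t, Real.exp (2 * z n)),
    fun t => χ₁ (t, Real.exp (2 * z n)), by fun_prop, by fun_prop, h0 _, h10 _,
    fun r hr => (hd _ r hr).1, ?_, ?_⟩⟩
  all_goals
    have hcl : max 0 (min (Real.exp (2 * z n)) 1) = Real.exp (2 * z n) := by
      rw [min_eq_left (Real.exp_le_one_iff.mpr (by linarith [(hz0 n).2])),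
        max_eq_right (Real.exp_pos _).le]
    have hd2 : ∀ r, 0 < r → HasDerivAt (fun t => χ₁ (t, Real.exp (2 * z n)))
        ((Real.exp (2 * z n) - Q r) * χ (r, Real.exp (2 * z n))) r := by
      intro r hr
      have := (hd (Real.exp (2 * z n)) r hr).2
      simp only [hcl] at this
      exact this
  · exact hd2
  · exact exists_exp_bound_of_matching hr₀ hK hQ₀ hg hg₁ hdec hne'
      (χ := fun t => χ (t, Real.exp (2 * z n))) (χ₁ := fun t => χ₁ (t, Real.exp (2 * z n)))
      (by fun_prop) (by fun_prop) (fun r hr => (hd _ r hr).1) hd2 (hz0 n).1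

theorem exists_efimov_sequence {μ ν : ℝ} (hμ : 0 < μ) (hν : 0 < ν) {θ : ℝ → ℝ}
    (hθ : ContDiffOn ℝ ((⊤ : ℕ∞) : WithTop ℕ∞) θ (Set.Ici 0)) (hθ0 : θ 0 = 1)
    (hθs : ∃ r₀ : ℝ, 0 < r₀ ∧ ∀ r : ℝ, r₀ ≤ r → θ r = 0)
    (hα : 1 / 4 < μ / ν * lambertW 1 ^ 2) :
    ∃ E : ℕ → ℝ, StrictMono E ∧
      (∀ n : ℕ, E n < 0 ∧ IsEigenvalue (slowHamiltonian μ (effPotential ν θ)) (E n : ℂ)) ∧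
      Tendsto E atTop (𝓝 0) ∧
      Tendsto (fun n : ℕ => E n / E (n + 1)) atTop
        (𝓝 (Real.exp (2 * Real.pi / Real.sqrt (μ / ν * lambertW 1 ^ 2 - 1 / 4)))) := by
  obtain ⟨r₀, hr₀, hθs⟩ := hθs
  obtain ⟨Q, K, hQ, hK, hQV, hQ₀⟩ := exists_continuous_potential hμ hν hθ hθ0 hr₀ hθs
  set β := Real.sqrt (μ / ν * lambertW 1 ^ 2 - 1 / 4) with hβ
  have hβ0 : 0 < β := Real.sqrt_pos.mpr (by linarith)
  have hβ2 : β ^ 2 + 1 / 4 = μ / ν * lambertW 1 ^ 2 := by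
    rw [hβ, Real.sq_sqrt (by linarith)]
    ring
  obtain ⟨z, hz, hzbot, hzd, hsol⟩ := exists_matching_sequence hβ0 hr₀ hQ hK
    (fun r hr => by rw [hβ2, hQ₀ r hr])
  -- The ratio of consecutive energies is exp(2(z n - z (n + 1))), so the spacing π/β yields the
  -- limit e^{2π/β}.
  refine ⟨fun n => -(Real.exp (2 * z n) / μ), fun m n hmn => ?_, fun n => ⟨?_, ?_⟩, ?_, ?_⟩
  · have h := hz hmn
    simp only [neg_lt_neg_iff]
    gcongr
  · have := Real.exp_pos (2 * z n)
    simp only [neg_lt_zero]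
    positivity
  · obtain ⟨χ, χ₁, hχ, hχ₁, h0, h10, h1, h2, C, k, hk, hb⟩ := hsol n
    exact isEigenvalue_slowHamiltonian hμ hQ hK hQV hχ hχ₁ h0 h10 h1 h2 hk hb
  · have h1 : Tendsto (fun n => Real.exp (2 * z n)) atTop (𝓝 0) :=
      Real.tendsto_exp_atBot.comp (hzbot.const_mul_atBot two_pos)
    simpa using (h1.div_const μ).neg
  · have h1 := (Real.continuous_exp.tendsto _).comp (hzd.const_mul 2)
    rw [← mul_div_assoc] at h1
    refine h1.congr fun n => ?_
    simp only [Function.comp]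
    rw [mul_sub, Real.exp_sub]
    have := (Real.exp_pos (2 * z (n + 1))).ne'
    field_simp

end BornOppenheimer

end

theorem theorem1 (μ ν : ℝ) (hμ : 0 < μ) (hν : 0 < ν) (θ : ℝ → ℝ)
    (hθ : ContDiffOn ℝ ((⊤ : ℕ∞) : WithTop ℕ∞) θ (Set.Ici 0)) (hθ0 : θ 0 = 1)
    (hθs : ∃ r₀ : ℝ, 0 < r₀ ∧ ∀ r : ℝ, r₀ ≤ r → θ r = 0) :
    (∀ (l : ℝ) (y : BornOppenheimer.R3), 0 < l → y ≠ 0 → θ ‖y‖ < 1 →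
      BornOppenheimer.effPotential ν θ ‖y‖ < 0 ∧
      BornOppenheimer.IsEigenvalue (BornOppenheimer.fastHamiltonian ν θ y l)
        (BornOppenheimer.effPotential ν θ ‖y‖ : ℂ) ∧
      (∀ e : ℝ, e < 0 →
        BornOppenheimer.IsEigenvalue (BornOppenheimer.fastHamiltonian ν θ y l) (e : ℂ) →
        e = BornOppenheimer.effPotential ν θ ‖y‖) ∧
      (∀ u : BornOppenheimer.L2,
        BornOppenheimer.IsEigenvector (BornOppenheimer.fastHamiltonian ν θ y l)
            (BornOppenheimer.effPotential ν θ ‖y‖ : ℂ) u ↔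
          ∃ q : ℂ, q ≠ 0 ∧ u =ᵐ[volume] fun x =>
            q * (BornOppenheimer.greenSum ν (-BornOppenheimer.effPotential ν θ ‖y‖) y x : ℂ))) ∧
    (1 / 4 < μ / ν * BornOppenheimer.lambertW 1 ^ 2 →
      ∃ E : ℕ → ℝ, StrictMono E ∧
        (∀ n : ℕ, E n < 0 ∧
          BornOppenheimer.IsEigenvalue
            (BornOppenheimer.slowHamiltonian μ (BornOppenheimer.effPotential ν θ)) (E n : ℂ)) ∧
        Tendsto E atTop (𝓝 0) ∧
        Tendsto (fun n : ℕ => E n / E (n + 1)) atTop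
          (𝓝 (Real.exp (2 * Real.pi /
            Real.sqrt (μ / ν * BornOppenheimer.lambertW 1 ^ 2 - 1 / 4))))) :=
  ⟨fun _ _ hl hy hy1 => BornOppenheimer.fastHamiltonian_spectrum hν θ hl hy hy1,
    fun hα => BornOppenheimer.exists_efimov_sequence hμ hν hθ hθ0 hθs hα⟩
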